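/- Let $\overline n=(n_i)_{i\ge 1}$ be a sequence of integers $n_i\ge 2$, put $p_m=n_1\cdots n_m$, and let $K$ be a field with an involution $a\mapsto a^*$ that is positive definite ($\sum_{i=1}^k a_i^*a_i=0$ implies $a_1=\dots=a_k=0$, for all $k$). *The algebra.* Let $X=\prod_i\{0,\dots,n_i-1\}$ with the product topology, and let $T$ be the odometer homeomorphism of $X$ (addition of $(1,0,0,\dots)$ with carry). Let $C_K(X)$ be the algebra of locally constant functions $X\to K$ with the pointwise involution, and let $\mathcal O(\overline n)=C_K(X)\rtimes_T\mathbb Z$ be the crossed product $*$-algebra: its elements are the finite sums $\sum_k f_kt^k$, with $tf=(f\circ T^{-1})t$, $(ft^k)^*=t^{-k}f^*$. *The rank completion.* Let $\mathfrak R_\infty=\varinjlim_m M_{p_m}(K)$ with respect to the block diagonal embeddings $x\mapsto\mathrm{diag}(x,\dots,x)$ ($n_{m+1}$ copies). It carries the rank function that is $\frac1{p_m}\mathrm{Rk}$ on $M_{p_m}(K)$; let $\mathfrak R_{\mathrm{rk}}$ be the completion of $\mathfrak R_\infty$ with respect to the metric $d(x,y)=\mathrm{rk}(x-y)$, with the $*$-algebra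 structure extended by continuity. There is a canonical $*$-homomorphism $\pi:\mathcal O(\overline n)\to\mathfrak R_{\mathrm{rk}}$: a function $f\in C_K(X)$ that depends only on the first $m$ coordinates is sent to the class of $\mathrm{diag}(f(0),f(T0),\dots,f(T^{p_m-1}0))\in M_{p_m}(K)$, and $t$ is sent to $\lim_m\sum_{i=0}^{p_m-2}e_{i+1,i}^{(m)}$, where $e^{(m)}_{ij}$ are the matrix units of $M_{p_m}(K)$. The *$*$-regular closure* $\mathcal R_{\mathcal O(\overline n)}$ is the smallest unital $*$-subring of $\mathfrak R_{\mathrm{rk}}$ that contains $\pi(\mathcal O(\overline n))$ and is $*$-regular (von Neumann regular, with $x^*x=0$ only for $x=0$). *The direct limit.* For each $m$ let $K(t^{p_m})$ be the field of rational functions in $t^{p_m}$, with the involution extending that of $K$ and sending $t^{p_m}$ to $t^{-p_m}$; matrix algebras carry the conjugate transpose. There is a $*$-embedding $M_{p_m}(K[t^{p_m},t^{-p_m}])\to M_{p_{m+1}}(K[t^{p_{m+1}},t^{-p_{m+1}}])$ which extends the block diagonal embedding $M_{p_m}(K)\to M_{p_{m+1}}(K)$ and sends $t^{p_m}\cdot\mathrm{Id}_{p_m}$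 to the $n_{m+1}\times n_{m+1}$ block matrix with blocks $\mathrm{Id}_{p_m}$ immediately below the diagonal, $t^{p_{m+1}}\cdot\mathrm{Id}_{p_m}$ in the upper right corner, and zeros elsewhere. It extends uniquely to a $*$-embedding $M_{p_m}(K(t^{p_m}))\to M_{p_{m+1}}(K(t^{p_{m+1}}))$. **Theorem.** There is an isomorphism of $*$-algebras over $K$ $$\mathcal R_{\mathcal O(\overline n)}\;\cong\;\varinjlim_m M_{p_m}(K(t^{p_m})),$$ where the direct limit is taken along the embeddings just described. -/

import Mathlib

noncomputable section

open scoped LaurentPolynomial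

set_option linter.unusedSectionVars false

namespace Odometer

/-! ### Sequential direct limits of `*`-algebras -/
section SeqLimit
variable {K : Type*} [Field K] {A : ℕ → Type*} [∀ m, Ring (A m)] [∀ m, StarRing (A m)]
  [∀ m, Algebra K (A m)]

/-- The composite `A i → A (i+1) → ⋯ → A j` of the connecting maps. -/
def transition (φ : ∀ m, A m →⋆ₐ[K] A (m + 1)) (i j : ℕ) (h : i ≤ j) : A i →⋆ₐ[K] A j :=
  Nat.leRec (motive := fun j _ => A i →⋆ₐ[K] A j) (StarAlgHom.id K (A i))
    (fun k _ f => (φ k).comp f) h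

theorem transition_self (φ : ∀ m, A m →⋆ₐ[K] A (m + 1)) (i : ℕ) :
    transition φ i i le_rfl = StarAlgHom.id K (A i) := by
  simp [transition]

theorem transition_succ (φ : ∀ m, A m →⋆ₐ[K] A (m + 1)) {i j : ℕ} (h : i ≤ j) :
    transition φ i (j + 1) (Nat.le_succ_of_le h) = (φ j).comp (transition φ i j h) := by
  simp only [transition]
  rw [Nat.leRec_succ]

instance (φ : ∀ m, A m →⋆ₐ[K] A (m + 1)) :
    DirectedSystem A (fun i j h => transition φ i j h) where
  map_self i x := by rw [transition_self]; rfl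
  map_map k j i hij hjk x := by
    induction hjk with
    | refl => rw [transition_self]; rfl
    | step h ih =>
      rw [transition_succ φ h, transition_succ φ (hij.trans h)]
      exact congrArg (φ _) ih

/-- The direct limit of `A 0 → A 1 → A 2 → ⋯`. -/
abbrev SeqLimit (φ : ∀ m, A m →⋆ₐ[K] A (m + 1)) : Type _ := DirectLimit A (transition φ)

variable (φ : ∀ m, A m →⋆ₐ[K] A (m + 1))

instance : StarRing (SeqLimit φ) where
  star_add := star_add

instance : Algebra K (SeqLimit φ) :=
  Algebra.ofModule (fun r x y => smul_mul_assoc r x y) (fun r x y => mul_smul_comm r x y)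

/-- The canonical map from the `m`-th algebra to the limit. -/
def SeqLimit.of (m : ℕ) : A m →⋆ₐ[K] SeqLimit φ where
  toFun x := ⟦⟨m, x⟩⟧
  map_one' := (DirectLimit.one_def m).symm
  map_mul' x y := (DirectLimit.mul_def m x y).symm
  map_zero' := (DirectLimit.zero_def m).symm
  map_add' x y := (DirectLimit.add_def m x y).symm
  commutes' r := by
    rw [Algebra.algebraMap_eq_smul_one, Algebra.algebraMap_eq_smul_one, DirectLimit.one_def m]
    rfl
  map_star' x := rfl

theorem SeqLimit.of_succ (m : ℕ) (x : A m) :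
    SeqLimit.of φ (m + 1) (φ m x) = SeqLimit.of φ m x := by
  have h := DirectLimit.mk_apply (f := transition φ) m (m + 1) x (Nat.le_succ m)
  rw [transition_succ φ le_rfl, transition_self] at h
  exact h
end SeqLimit

/-! ### Block embeddings of matrix algebras -/
section Block
variable {K : Type*} [Field K] {R S : Type*} [Ring R] [StarRing R] [Algebra K R]
  [Ring S] [StarRing S] [Algebra K S]

theorem divNat_modNat_ext_iff {q p : ℕ} (a b : Fin (q * p)) :
    a = b ↔ a.divNat = b.divNat ∧ a.modNat = b.modNat := by
  rw [← finProdFinEquiv.symm.injective.eq_iff]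
  exact Prod.ext_iff

/-- `M_p(R) → M_{qp}(S)` obtained by applying `ψ : R → M_q(S)` to each entry: the result consists of
`q × q` blocks of size `p × p`, and its block in position `(k, l)` has entries `ψ(M i j) k l`. -/
def blockHom (p q : ℕ) (ψ : R →⋆ₐ[K] Matrix (Fin q) (Fin q) S) :
    Matrix (Fin p) (Fin p) R →⋆ₐ[K] Matrix (Fin (q * p)) (Fin (q * p)) S where
  toFun M := Matrix.of fun a b => ψ (M a.modNat b.modNat) a.divNat b.divNat
  map_one' := by
    ext a b
    have hab := divNat_modNat_ext_iff a b
    by_cases h : a.modNat = b.modNat <;> simp [Matrix.one_apply, h, hab]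
  map_mul' M N := by
    ext a b
    rw [Matrix.mul_apply, ← finProdFinEquiv.sum_comp, Fintype.sum_prod_type]
    simp only [Matrix.of_apply, Matrix.mul_apply, map_sum, map_mul, Matrix.sum_apply]
    rw [Finset.sum_comm]
    refine Finset.sum_congr rfl fun i _ => Finset.sum_congr rfl fun j _ => ?_
    have h := finProdFinEquiv.symm_apply_apply (i, j)
    have h1 : (finProdFinEquiv (i, j)).divNat = i := congrArg Prod.fst h
    have h2 : (finProdFinEquiv (i, j)).modNat = j := congrArg Prod.snd h
    rw [h1, h2]
  map_zero' := by ext; simp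
  map_add' M N := by ext; simp
  commutes' r := by
    ext a b
    have hab := divNat_modNat_ext_iff a b
    by_cases h : a.modNat = b.modNat <;>
      simp [Matrix.algebraMap_matrix_apply, h, hab, AlgHomClass.commutes]
  map_star' M := by
    ext a b
    simp [Matrix.star_apply, map_star]

end Block

/-! ### Laurent polynomials, rational functions -/
section Rational
variable (K : Type*) [Field K] [StarRing K]

/-- Laurent polynomials carry the involution `(∑ aₙ sⁿ)^* = ∑ (aₙ)^* s⁻ⁿ`. -/
instance : StarRing K[T;T⁻¹] where
  star f := LaurentPolynomial.invert (AddMonoidAlgebra.mapRingHom ℤ (starRingEnd K) f)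
  star_involutive f := by
    ext n
    simp
  star_mul f g := by
    rw [map_mul, map_mul, mul_comm]
  star_add f g := by
    rw [map_add, map_add]

theorem star_T (n : ℤ) : star (LaurentPolynomial.T n : K[T;T⁻¹]) = LaurentPolynomial.T (-n) := by
  change LaurentPolynomial.invert
    (AddMonoidAlgebra.mapRingHom ℤ (starRingEnd K) (LaurentPolynomial.T n)) = _
  rw [LaurentPolynomial.T, AddMonoidAlgebra.mapRingHom_single, map_one]
  exact LaurentPolynomial.invert_T n

theorem star_algebraMap_laurent (r : K) :
    star (algebraMap K K[T;T⁻¹] r) = algebraMap K K[T;T⁻¹] (star r) := by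
  rw [← LaurentPolynomial.C_eq_algebraMap]
  change LaurentPolynomial.invert
    (AddMonoidAlgebra.mapRingHom ℤ (starRingEnd K) (LaurentPolynomial.C r)) = _
  rw [← LaurentPolynomial.single_eq_C, AddMonoidAlgebra.mapRingHom_single,
    LaurentPolynomial.single_eq_C]
  exact LaurentPolynomial.invert_C _

/-- The field `K(s)` of rational functions: the field of fractions of `K[s, s⁻¹]`. -/
abbrev RationalFunctions : Type _ := FractionRing K[T;T⁻¹]

/-- `K(s)` carries the unique involution extending that of `K[s, s⁻¹]`. -/
instance : StarRing (RationalFunctions K) where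
  star := IsLocalization.map (M := nonZeroDivisors K[T;T⁻¹]) (T := nonZeroDivisors K[T;T⁻¹])
    (RationalFunctions K) (starRingEnd K[T;T⁻¹])
    (nonZeroDivisors_le_comap_nonZeroDivisors_of_injective _ star_injective)
  star_involutive f := by
    rw [IsLocalization.map_map]
    have h : (starRingEnd K[T;T⁻¹]).comp (starRingEnd K[T;T⁻¹]) = RingHom.id _ :=
      RingHom.ext fun x => star_star x
    simp only [h]
    exact IsLocalization.map_id _ _
  star_mul f g := by rw [map_mul, mul_comm]
  star_add f g := by rw [map_add]

theorem star_algebraMap_rational (f : K[T;T⁻¹]) :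
    star (algebraMap K[T;T⁻¹] (RationalFunctions K) f) = algebraMap _ _ (star f) :=
  IsLocalization.map_eq _ f

/-- The `q × q` matrix with ones immediately below the diagonal and `s` in the upper right corner. -/
def companion (q : ℕ) : Matrix (Fin q) (Fin q) K[T;T⁻¹] :=
  Matrix.of fun a b =>
    if (a : ℕ) = b + 1 then 1
    else if (a : ℕ) = 0 ∧ (b : ℕ) + 1 = q then LaurentPolynomial.T 1 else 0

variable {K} in
theorem companion_mul (q : ℕ) (M : Matrix (Fin q) (Fin q) K[T;T⁻¹]) (a b : Fin q) :
    (companion K q * M) a b = if h : (a : ℕ) = 0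
      then LaurentPolynomial.T 1 * M ⟨q - 1, by omega⟩ b else M ⟨a - 1, by omega⟩ b := by
  rw [Matrix.mul_apply]
  split_ifs with h
  · rw [Finset.sum_eq_single (⟨q - 1, by omega⟩ : Fin q)]
    · have h1 : q - 1 + 1 = q := by omega
      have h2 : ¬ 0 = q := by omega
      simp [companion, h, h1, h2]
    · intro c _ hc
      have : ¬ (c : ℕ) + 1 = q := fun h' => hc (Fin.ext (by simp; omega))
      simp [companion, h, this]
    · simp
  · rw [Finset.sum_eq_single (⟨a - 1, by omega⟩ : Fin q)]
    · have : (a : ℕ) = a - 1 + 1 := by omega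
      simp [companion, ← this]
    · intro c _ hc
      have : ¬ (a : ℕ) = c + 1 := fun h' => hc (Fin.ext (by simp; omega))
      simp [companion, h, this]
    · simp

theorem companion_mul_star (q : ℕ) : companion K q * star (companion K q) = 1 := by
  ext1 a b
  have hT : (LaurentPolynomial.T 1 * LaurentPolynomial.T (-1) : K[T;T⁻¹]) = 1 := by
    rw [← LaurentPolynomial.T_add]; simp
  rw [companion_mul, Matrix.one_apply]
  simp only [Matrix.star_apply, companion, Matrix.of_apply, Fin.ext_iff]
  split_ifs <;> first | omega | simp [star_T, hT] 

theorem companion_pow (q k : ℕ) (hk : k ≤ q) : companion K q ^ k =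
    Matrix.of fun a b : Fin q => if (a : ℕ) = b + k then 1
      else if (a : ℕ) + q = b + k then LaurentPolynomial.T 1 else 0 := by
  induction k with
  | zero =>
    ext1 a b
    rw [pow_zero, Matrix.one_apply]
    simp only [Matrix.of_apply, Fin.ext_iff]
    split_ifs <;> first | omega | rfl
  | succ k ih =>
    ext1 a b
    rw [pow_succ', ih (by omega), companion_mul]
    simp only [Matrix.of_apply]
    split_ifs <;> first | omega | simp

/-- The companion matrix as an invertible matrix. -/
def companionUnit (q : ℕ) : (Matrix (Fin q) (Fin q) K[T;T⁻¹])ˣ where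
  val := companion K q
  inv := star (companion K q)
  val_inv := companion_mul_star K q
  inv_val := mul_eq_one_comm.mp (companion_mul_star K q)

/-- The `K`-algebra embedding `K[s, s⁻¹] → M_q(K[s', s'⁻¹])` sending `s` to the companion matrix
(so that `s ^ q` goes to `s' • 1`). -/
def laurentHom (q : ℕ) : K[T;T⁻¹] →ₐ[K] Matrix (Fin q) (Fin q) K[T;T⁻¹] :=
  AddMonoidAlgebra.lift K _ ℤ ((Units.coeHom _).comp (zpowersHom _ (companionUnit K q)))

theorem laurentHom_T (q : ℕ) (n : ℤ) : laurentHom K q (LaurentPolynomial.T n) =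
    ((companionUnit K q ^ n : (Matrix (Fin q) (Fin q) K[T;T⁻¹])ˣ) : Matrix _ _ _) := by
  rw [LaurentPolynomial.T, laurentHom, AddMonoidAlgebra.lift_single, one_smul]
  simp

theorem laurentHom_star (q : ℕ) (f : K[T;T⁻¹]) :
    laurentHom K q (star f) = star (laurentHom K q f) := by
  induction f using LaurentPolynomial.induction_on' with
  | add f g hf hg => simp only [star_add, map_add, hf, hg]
  | C_mul_T n a =>
    have hU : star (companionUnit K q) = (companionUnit K q)⁻¹ := Units.ext rfl
    rw [star_mul', map_mul, map_mul, star_mul, star_T, laurentHom_T, laurentHom_T,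
      LaurentPolynomial.C_eq_algebraMap, star_algebraMap_laurent, AlgHom.commutes,
      AlgHom.commutes, ← Units.coe_star, star_zpow, hU, inv_zpow', Algebra.commutes]
    congr 1
    ext i j
    by_cases h : i = j
    · subst h
      rw [Matrix.star_apply, Matrix.algebraMap_matrix_apply, Matrix.algebraMap_matrix_apply,
        if_pos rfl, if_pos rfl, star_algebraMap_laurent]
    · simp [Matrix.star_apply, Matrix.algebraMap_matrix_apply, h, Ne.symm h]

/-- `laurentHom` as a `*`-homomorphism. -/
def laurentStarHom (q : ℕ) : K[T;T⁻¹] →⋆ₐ[K] Matrix (Fin q) (Fin q) K[T;T⁻¹] where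
  __ := laurentHom K q
  map_star' := laurentHom_star K q

/-- The embedding `K[s, s⁻¹] → M_q(K[s', s'⁻¹])` followed by the inclusion into `M_q(K(s'))`. -/
def laurentToRational (q : ℕ) :
    K[T;T⁻¹] →+* Matrix (Fin q) (Fin q) (RationalFunctions K) :=
  (algebraMap K[T;T⁻¹] (RationalFunctions K)).mapMatrix.comp (laurentHom K q).toRingHom

/-- The endomorphism `f(s) ↦ f(s ^ q)` of `K[s, s⁻¹]`. -/
def powHom (q : ℕ) : K[T;T⁻¹] →ₐ[K] K[T;T⁻¹] :=
  AddMonoidAlgebra.lift K _ ℤ ((Units.coeHom _).comp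
    (zpowersHom _ ((LaurentPolynomial.isUnit_T (R := K) q).unit)))

theorem powHom_T (q : ℕ) (n : ℤ) :
    powHom K q (LaurentPolynomial.T n) = LaurentPolynomial.T (q * n) := by
  have h : (LaurentPolynomial.isUnit_T (R := K) q).unit ^ n =
      (LaurentPolynomial.isUnit_T (R := K) (q * n)).unit := by
    induction n with
    | zero => ext1; simp
    | succ n ih =>
      rw [zpow_add_one, ih]
      ext1
      rw [Units.val_mul, IsUnit.unit_spec, IsUnit.unit_spec, IsUnit.unit_spec,
        ← LaurentPolynomial.T_add, mul_add, mul_one]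
    | pred n ih =>
      rw [zpow_sub_one, ih, mul_inv_eq_iff_eq_mul]
      ext1
      rw [Units.val_mul, IsUnit.unit_spec, IsUnit.unit_spec, IsUnit.unit_spec,
        ← LaurentPolynomial.T_add]
      congr 1
      ring
  have h2 : powHom K q (AddMonoidAlgebra.single n 1) =
      (((LaurentPolynomial.isUnit_T (R := K) q).unit ^ n : K[T;T⁻¹]ˣ) : K[T;T⁻¹]) := by
    rw [powHom, AddMonoidAlgebra.lift_single, one_smul]
    simp
  rw [h, IsUnit.unit_spec] at h2
  exact h2

theorem laurentHom_powHom (q : ℕ) (f : K[T;T⁻¹]) :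
    laurentHom K q (powHom K q f) = algebraMap K[T;T⁻¹] _ f := by
  have h : (companion K q) ^ q = algebraMap K[T;T⁻¹] _ (LaurentPolynomial.T 1) := by
    rw [companion_pow K q q le_rfl]
    ext1 a b
    rw [Matrix.algebraMap_matrix_apply]
    simp only [Matrix.of_apply, Fin.ext_iff]
    split_ifs <;> first | omega | rfl
  have h2 : (laurentHom K q).comp (powHom K q) =
      IsScalarTower.toAlgHom K K[T;T⁻¹] (Matrix (Fin q) (Fin q) K[T;T⁻¹]) := by
    apply AddMonoidAlgebra.algHom_ext'
    case single_one_left => exact Subsingleton.elim _ _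
    apply MonoidHom.ext_mint
    change laurentHom K q (powHom K q (LaurentPolynomial.T 1)) =
      algebraMap K[T;T⁻¹] _ (LaurentPolynomial.T 1)
    rw [powHom_T, laurentHom_T, ← h, mul_one, zpow_natCast, Units.val_pow_eq_pow_val]
    rfl
  exact DFunLike.congr_fun h2 f

theorem powHom_isIntegral {q : ℕ} (hq : q ≠ 0) (f : K[T;T⁻¹]) :
    (powHom K q).toRingHom.IsIntegralElem f := by
  induction f using LaurentPolynomial.induction_on' with
  | add f g hf hg => exact hf.add _ hg
  | C_mul_T n a =>
    refine RingHom.IsIntegralElem.mul _ ?_ ?_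
    · have h : (powHom K q).toRingHom (LaurentPolynomial.C a) = LaurentPolynomial.C a := by
        rw [LaurentPolynomial.C_eq_algebraMap]
        exact (powHom K q).commutes a
      rw [← h]
      exact RingHom.isIntegralElem_map _
    · refine ⟨Polynomial.X ^ q - Polynomial.C (LaurentPolynomial.T n),
        Polynomial.monic_X_pow_sub_C _ hq, ?_⟩
      simp [powHom_T]

theorem exists_mul_eq_of_isIntegralElem {R S : Type*} [CommRing R] [Nontrivial R] [CommRing S]
    [IsDomain S] (φ : R →+* S) {f : S} (hf : f ≠ 0) (hi : φ.IsIntegralElem f) :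
    ∃ h ≠ 0, ∃ g, g * f = φ h := by
  let _ := φ.toAlgebra
  obtain ⟨h, hmem, h0⟩ := Submodule.exists_mem_ne_zero_of_ne_bot
    (Ideal.comap_ne_bot_of_integral_mem (R := R) hf (Ideal.mem_span_singleton_self f) hi)
  exact ⟨h, h0, Ideal.mem_span_singleton'.mp (Ideal.mem_comap.mp hmem)⟩

/-- Non-zero Laurent polynomials become invertible matrices over `K(s')`. -/
theorem isUnit_laurentToRational (q : ℕ) {f : K[T;T⁻¹]} (hf : f ≠ 0) :
    IsUnit (laurentToRational K q f) := by
  rcases eq_or_ne q 0 with rfl | hq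
  · exact isUnit_of_subsingleton _
  obtain ⟨h, h0, g, hg⟩ := exists_mul_eq_of_isIntegralElem _ hf (powHom_isIntegral K hq f)
  have key : IsUnit (laurentToRational K q (g * f)) := by
    rw [hg]
    change IsUnit ((laurentHom K q (powHom K q h)).map (algebraMap _ (RationalFunctions K)))
    rw [laurentHom_powHom]
    have h1 : (algebraMap K[T;T⁻¹] (Matrix (Fin q) (Fin q) K[T;T⁻¹]) h).map
        (algebraMap _ (RationalFunctions K)) =
        algebraMap (RationalFunctions K) _ (algebraMap _ (RationalFunctions K) h) := by
      ext i j
      by_cases hij : i = j <;> simp [Matrix.algebraMap_matrix_apply, hij]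
    rw [h1]
    exact (IsUnit.mk0 _ (by simpa using h0)).map _
  rw [map_mul] at key
  exact ((Commute.isUnit_mul_iff (by
    rw [commute_iff_eq, ← map_mul, ← map_mul, mul_comm])).mp key).2

/-- The embedding `K(s) → M_q(K(s'))` extending `laurentHom`, as a ring homomorphism. -/
def rationalRingHom (q : ℕ) :
    RationalFunctions K →+* Matrix (Fin q) (Fin q) (RationalFunctions K) :=
  OreLocalization.universalHom (laurentToRational K q)
    (IsUnit.liftRight ((laurentToRational K q : _ →* Matrix _ _ _).comp
        (nonZeroDivisors K[T;T⁻¹]).subtype)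
      fun f => isUnit_laurentToRational K q (nonZeroDivisors.coe_ne_zero f))
    (fun _ => rfl)

theorem rationalRingHom_algebraMap (q : ℕ) (f : K[T;T⁻¹]) :
    rationalRingHom K q (algebraMap _ _ f) =
      (laurentHom K q f).map (algebraMap K[T;T⁻¹] (RationalFunctions K)) :=
  OreLocalization.universalHom_commutes _ _ _

theorem rationalRingHom_star (q : ℕ) (f : RationalFunctions K) :
    rationalRingHom K q (star f) = star (rationalRingHom K q f) := by
  have hL (g : K[T;T⁻¹]) : rationalRingHom K q (star (algebraMap _ _ g)) =
      star (rationalRingHom K q (algebraMap _ _ g)) := by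
    rw [star_algebraMap_rational, rationalRingHom_algebraMap, rationalRingHom_algebraMap,
      laurentHom_star]
    ext i j
    simp [Matrix.star_apply, star_algebraMap_rational]
  obtain ⟨a, b, hb, rfl⟩ := IsFractionRing.div_surjective (A := K[T;T⁻¹]) f
  set x := algebraMap K[T;T⁻¹] (RationalFunctions K) a / algebraMap _ _ b with hx
  have hb0 : algebraMap K[T;T⁻¹] (RationalFunctions K) b ≠ 0 := by
    simpa using nonZeroDivisors.ne_zero hb
  have hxb : algebraMap K[T;T⁻¹] (RationalFunctions K) b * x = algebraMap _ _ a := by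
    rw [hx]; field_simp
  have hu : IsUnit (rationalRingHom K q (star (algebraMap _ _ b))) :=
    (IsUnit.mk0 _ (by simpa using hb0)).map _
  refine hu.mul_right_cancel ?_
  rw [← map_mul, ← star_mul, hxb, hL, hL, ← star_mul, ← map_mul, hxb]

/-- The embedding `K(s) → M_q(K(s'))` induced by the embedding
`laurentHom : K[s, s⁻¹] → M_q(K[s', s'⁻¹])`. -/
def rationalHom (q : ℕ) :
    RationalFunctions K →⋆ₐ[K] Matrix (Fin q) (Fin q) (RationalFunctions K) where
  __ := rationalRingHom K q
  commutes' r := by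
    change rationalRingHom K q (algebraMap K (RationalFunctions K) r) = _
    rw [IsScalarTower.algebraMap_apply K K[T;T⁻¹] (RationalFunctions K),
      rationalRingHom_algebraMap, AlgHom.commutes]
    ext i j
    by_cases hij : i = j <;> simp [Matrix.algebraMap_matrix_apply, hij,
      IsScalarTower.algebraMap_apply K K[T;T⁻¹] (RationalFunctions K)]
  map_star' f := rationalRingHom_star K q f
end Rational

/-! ### The matrix algebras attached to a sequence `n` -/
section Levels
variable (n : ℕ → ℕ) (K : Type*) [Field K] [StarRing K]

/-- `p m` is the product of the first `m` terms of the sequence `n`. -/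
def p : ℕ → ℕ
  | 0 => 1
  | m + 1 => n m * p m

/-- The block diagonal embedding `x ↦ diag(x, …, x)` of `M_{p m}(K)` into `M_{p (m+1)}(K)`. -/
def constStep (m : ℕ) : Matrix (Fin (p n m)) (Fin (p n m)) K →⋆ₐ[K]
    Matrix (Fin (p n (m + 1))) (Fin (p n (m + 1))) K :=
  blockHom (p n m) (n m) (StarAlgHom.ofId K _)

/-- The embedding of `M_{p m}(K[s, s⁻¹])`, `s = t ^ p m`, into `M_{p (m+1)}(K[s', s'⁻¹])`,
`s' = t ^ p (m+1)`. It extends `constStep` and sends `s • 1` to the `n m × n m` block matrix that has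
identity blocks (of size `p m`) immediately below the diagonal, `s' • 1` in the upper right corner,
and zero blocks elsewhere. -/
def laurentStep (m : ℕ) : Matrix (Fin (p n m)) (Fin (p n m)) K[T;T⁻¹] →⋆ₐ[K]
    Matrix (Fin (p n (m + 1))) (Fin (p n (m + 1))) K[T;T⁻¹] :=
  blockHom (p n m) (n m) (laurentStarHom K (n m))

/-- The embedding of `M_{p m}(K(s))`, `s = t ^ p m`, into `M_{p (m+1)}(K(s'))`,
`s' = t ^ p (m+1)`, which is induced by `laurentStep`. -/
def rationalStep (m : ℕ) : Matrix (Fin (p n m)) (Fin (p n m)) (RationalFunctions K) →⋆ₐ[K]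
    Matrix (Fin (p n (m + 1))) (Fin (p n (m + 1))) (RationalFunctions K) :=
  blockHom (p n m) (n m) (rationalHom K (n m))

/-- `rationalStep` extends `laurentStep`. -/
theorem rationalStep_map (m : ℕ) (x : Matrix (Fin (p n m)) (Fin (p n m)) K[T;T⁻¹]) :
    rationalStep n K m (x.map (algebraMap K[T;T⁻¹] (RationalFunctions K))) =
      (laurentStep n K m x).map (algebraMap K[T;T⁻¹] (RationalFunctions K)) :=
  Matrix.ext fun _ _ => congrFun (congrFun (rationalRingHom_algebraMap K (n m) _) _) _

/-- The direct limit of the `M_{p m}(K(t ^ p m))`. At level `m` the indeterminate `s` of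
`RationalFunctions K` stands for `t ^ p m`. -/
abbrev RationalLimit : Type _ := SeqLimit (rationalStep n K)

/-- The direct limit of the `M_{p m}(K)`. -/
def MatrixLimit : Type _ := SeqLimit (constStep n K)

instance : Ring (MatrixLimit n K) := inferInstanceAs (Ring (SeqLimit (constStep n K)))
instance : StarRing (MatrixLimit n K) := inferInstanceAs (StarRing (SeqLimit (constStep n K)))
instance : Algebra K (MatrixLimit n K) := inferInstanceAs (Algebra K (SeqLimit (constStep n K)))

/-- The canonical map `M_{p m}(K) → MatrixLimit n K`. -/
def MatrixLimit.of (m : ℕ) : Matrix (Fin (p n m)) (Fin (p n m)) K →⋆ₐ[K] MatrixLimit n K :=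
  SeqLimit.of (constStep n K) m

variable {n K} in
theorem MatrixLimit.of_succ (m : ℕ) (x : Matrix (Fin (p n m)) (Fin (p n m)) K) :
    MatrixLimit.of n K (m + 1) (constStep n K m x) = MatrixLimit.of n K m x :=
  SeqLimit.of_succ (constStep n K) m x

variable {n K} in
theorem MatrixLimit.induction₂ {C : MatrixLimit n K → MatrixLimit n K → Prop}
    (h : ∀ m x y, C (MatrixLimit.of n K m x) (MatrixLimit.of n K m y)) (x y) : C x y :=
  DirectLimit.induction₂ _ h x y

theorem finrank_range_compLeft {V W : Type*} [AddCommGroup V] [Module K V] [AddCommGroup W]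
    [Module K W] [FiniteDimensional K V] [FiniteDimensional K W] (f : V →ₗ[K] W) (q : ℕ) :
    Module.finrank K (LinearMap.range (f.compLeft (Fin q))) =
      q * Module.finrank K (LinearMap.range f) := by
  have h : LinearMap.range (f.compLeft (Fin q)) =
      LinearMap.range ((LinearMap.range f).subtype.compLeft (Fin q)) := by
    rw [LinearMap.range_compLeft, LinearMap.range_compLeft, Submodule.range_subtype]
  rw [h, LinearMap.finrank_range_of_inj]
  · rw [Module.finrank_pi_fintype]
    simp
  · intro x y hxy
    ext1 i
    exact Subtype.ext (congrFun hxy i)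

theorem rank_constStep (m : ℕ) (x : Matrix (Fin (p n m)) (Fin (p n m)) K) :
    (constStep n K m x).rank = n m * x.rank := by
  have h1 (q r : ℕ) (x : Matrix (Fin r) (Fin r) K) :
      (blockHom r q (StarAlgHom.ofId K (Matrix (Fin q) (Fin q) K)) x).rank = q * x.rank := by
    let e : (Fin (q * r) → K) ≃ₗ[K] (Fin q → Fin r → K) :=
      (LinearEquiv.funCongrLeft K K finProdFinEquiv).trans (LinearEquiv.curry K K (Fin q) (Fin r))
    have h2 : (blockHom r q (StarAlgHom.ofId K (Matrix (Fin q) (Fin q) K)) x).mulVecLin =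
        e.symm.toLinearMap ∘ₗ (x.mulVecLin.compLeft (Fin q)) ∘ₗ e.toLinearMap := by
      refine LinearMap.ext fun v => funext fun a => ?_
      have h3 : (e.symm.toLinearMap ∘ₗ (x.mulVecLin.compLeft (Fin q)) ∘ₗ e.toLinearMap) v a =
        ∑ j, x a.modNat j * v (finProdFinEquiv (a.divNat, j)) := rfl
      rw [h3]
      change ∑ b : Fin (q * r), _ * _ = _
      rw [← finProdFinEquiv.sum_comp, Fintype.sum_prod_type, Finset.sum_comm]
      refine Finset.sum_congr rfl fun j _ => ?_
      rw [Finset.sum_eq_single a.divNat]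
      · have h := finProdFinEquiv.symm_apply_apply (a.divNat, j)
        have h1 : (finProdFinEquiv (a.divNat, j)).divNat = a.divNat := congrArg Prod.fst h
        have h2 : (finProdFinEquiv (a.divNat, j)).modNat = j := congrArg Prod.snd h
        simp [blockHom, h1, h2, StarAlgHom.ofId_apply, Matrix.algebraMap_matrix_apply]
      · intro i _ hi
        have h := finProdFinEquiv.symm_apply_apply (i, j)
        have h1 : (finProdFinEquiv (i, j)).divNat = i := congrArg Prod.fst h
        simp [blockHom, h1, StarAlgHom.ofId_apply, Matrix.algebraMap_matrix_apply, Ne.symm hi]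
      · simp
    rw [Matrix.rank, h2, Matrix.rank, ← finrank_range_compLeft, LinearMap.range_comp,
      LinearMap.range_comp, LinearEquiv.range, Submodule.map_top]
    exact LinearEquiv.finrank_map_eq e.symm _
  exact h1 _ _ x

theorem rank_star {r : ℕ} (x : Matrix (Fin r) (Fin r) K) : (star x).rank = x.rank := by
  rw [Matrix.star_eq_conjTranspose, Matrix.conjTranspose,
    ← Matrix.rank_transpose, ← Matrix.transpose_map, Matrix.transpose_transpose]
  have h1 (y : Matrix (Fin r) (Fin r) K) (v : Fin r → K) :
      (y.map star).mulVec (star v) = star (y.mulVec v) := by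
    funext i
    simp [Matrix.mulVec, dotProduct]
  let j : LinearMap.range x.mulVecLin ≃+ LinearMap.range (x.map star).mulVecLin :=
    { toFun := fun v => ⟨star v.1, by
        obtain ⟨w, hw⟩ := v.2
        exact ⟨star w, by rw [← hw]; exact h1 x w⟩⟩
      invFun := fun v => ⟨star v.1, by
        obtain ⟨w, hw⟩ := v.2
        refine ⟨star w, ?_⟩
        rw [← hw, Matrix.mulVecLin_apply, Matrix.mulVecLin_apply, ← h1]
        congr 1
        ext
        simp⟩
      left_inv := fun v => Subtype.ext (star_star _)
      right_inv := fun v => Subtype.ext (star_star _)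
      map_add' := fun v w => Subtype.ext (star_add _ _) }
  have h2 := rank_eq_of_equiv_equiv (star : K → K) j star_involutive.bijective
    (fun c v => Subtype.ext (star_smul _ _))
  exact (congrArg Cardinal.toNat h2).symm

theorem rank_add_le {r : ℕ} (x y : Matrix (Fin r) (Fin r) K) :
    (x + y).rank ≤ x.rank + y.rank := by
  have h : LinearMap.range (x + y).mulVecLin ≤
      LinearMap.range x.mulVecLin ⊔ LinearMap.range y.mulVecLin := by
    rintro _ ⟨v, rfl⟩
    rw [Matrix.mulVecLin_add, LinearMap.add_apply]
    exact Submodule.add_mem_sup ⟨v, rfl⟩ ⟨v, rfl⟩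
  exact (Submodule.finrank_mono h).trans (Submodule.finrank_add_le_finrank_add_finrank _ _)

end Levels

/-! ### The rank metric and the rank completion -/
section Completion
variable (n : ℕ → ℕ) [∀ i, (n i).AtLeastTwo] (K : Type*) [Field K] [StarRing K]

theorem two_pow_le_p (m : ℕ) : 2 ^ m ≤ p n m := by
  induction m with
  | zero => simp [p]
  | succ m ih =>
    rw [pow_succ', p]
    exact Nat.mul_le_mul (Nat.AtLeastTwo.prop) ih

theorem p_pos (m : ℕ) : 0 < p n m := (Nat.two_pow_pos m).trans_le (two_pow_le_p n m)

variable {n K} in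
/-- The normalized rank: the class of `x ∈ M_{p m}(K)` has rank `Rk(x) / p m`, where `1 / p m` is
the product measure of a cylinder set with `m` prescribed digits. -/
def MatrixLimit.rank : MatrixLimit n K → ℝ :=
  DirectLimit.lift (transition (constStep n K)) (fun m x => (x.rank : ℝ) / p n m) <| by
    intro i j h x
    induction h with
    | refl => rw [transition_self]; rfl
    | @step k h ih =>
      rw [transition_succ _ h, ih]
      have h1 := rank_constStep n K k (transition (constStep n K) _ _ h x)
      have h2 : (p n k : ℝ) ≠ 0 := Nat.cast_ne_zero.mpr (p_pos n k).ne'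
      have h3 : (n k : ℝ) ≠ 0 := Nat.cast_ne_zero.mpr (NeZero.ne (n k))
      change _ = ((constStep n K k (transition (constStep n K) _ _ h x)).rank : ℝ) / _
      rw [h1, p]
      push_cast
      rw [mul_div_mul_left _ _ h3]

variable {n K}

theorem MatrixLimit.rank_of (m : ℕ) (x : Matrix (Fin (p n m)) (Fin (p n m)) K) :
    (MatrixLimit.of n K m x).rank = (x.rank : ℝ) / p n m := rfl

theorem MatrixLimit.rank_add_le (x y : MatrixLimit n K) : (x + y).rank ≤ x.rank + y.rank := by
  induction x, y using MatrixLimit.induction₂ with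
  | h m x y =>
    rw [← map_add, rank_of, rank_of, rank_of, ← add_div]
    gcongr
    exact_mod_cast Odometer.rank_add_le K x y

theorem MatrixLimit.rank_mul_le_left (x y : MatrixLimit n K) : (x * y).rank ≤ x.rank := by
  induction x, y using MatrixLimit.induction₂ with
  | h m x y =>
    rw [← map_mul, rank_of, rank_of]
    gcongr
    exact_mod_cast Matrix.rank_mul_le_left x y

theorem MatrixLimit.rank_mul_le_right (x y : MatrixLimit n K) : (x * y).rank ≤ y.rank := by
  induction x, y using MatrixLimit.induction₂ with
  | h m x y =>
    rw [← map_mul, rank_of, rank_of]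
    gcongr
    exact_mod_cast Matrix.rank_mul_le_right x y

theorem MatrixLimit.rank_zero : (0 : MatrixLimit n K).rank = 0 := by
  rw [← map_zero (MatrixLimit.of n K 0), rank_of, Matrix.rank_zero]
  simp

theorem MatrixLimit.rank_smul_le (c : K) (x : MatrixLimit n K) : (c • x).rank ≤ x.rank := by
  rw [Algebra.smul_def]
  exact rank_mul_le_right _ _

theorem MatrixLimit.rank_neg (x : MatrixLimit n K) : (-x).rank = x.rank := by
  refine le_antisymm ?_ ?_
  · simpa using rank_smul_le (-1 : K) x
  · simpa using rank_smul_le (-1 : K) (-x)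

theorem MatrixLimit.rank_star (x : MatrixLimit n K) : (star x).rank = x.rank := by
  refine DirectLimit.induction _ (C := fun x : MatrixLimit n K => (star x).rank = x.rank) ?_ x
  intro m x
  change (star (MatrixLimit.of n K m x)).rank = (MatrixLimit.of n K m x).rank
  rw [← map_star, rank_of, rank_of, Odometer.rank_star]

/-- The limit of the `M_{p m}(K)` with the metric `d(x, y) = rk(x - y)`. -/
instance : SeminormedAddCommGroup (MatrixLimit n K) :=
  AddGroupSeminorm.toSeminormedAddCommGroup
    { toFun := MatrixLimit.rank
      map_zero' := MatrixLimit.rank_zero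
      add_le' := MatrixLimit.rank_add_le
      neg' := MatrixLimit.rank_neg }

theorem MatrixLimit.norm_def (x : MatrixLimit n K) : ‖x‖ = x.rank := rfl

theorem MatrixLimit.dist_def (x y : MatrixLimit n K) : dist x y = (x - y).rank :=
  dist_eq_norm x y

instance : IsTopologicalRing (MatrixLimit n K) where
  continuous_mul := by
    refine LipschitzWith.continuous (K := 2) (LipschitzWith.of_dist_le_mul fun x y => ?_)
    have h : x.1 * x.2 - y.1 * y.2 = (x.1 - y.1) * x.2 + y.1 * (x.2 - y.2) := by noncomm_ring
    rw [MatrixLimit.dist_def, h]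
    refine (MatrixLimit.rank_add_le _ _).trans ?_
    have h1 := MatrixLimit.rank_mul_le_left (x.1 - y.1) x.2
    have h2 := MatrixLimit.rank_mul_le_right y.1 (x.2 - y.2)
    have h3 : dist x.1 y.1 ≤ dist x y := le_max_left _ _
    have h4 : dist x.2 y.2 ≤ dist x y := le_max_right _ _
    rw [MatrixLimit.dist_def] at h3 h4
    push_cast
    linarith

instance : UniformContinuousConstSMul K (MatrixLimit n K) where
  uniformContinuous_const_smul c := by
    refine LipschitzWith.uniformContinuous (K := 1) (LipschitzWith.of_dist_le_mul fun x y => ?_)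
    rw [MatrixLimit.dist_def, MatrixLimit.dist_def, ← smul_sub, NNReal.coe_one, one_mul]
    exact MatrixLimit.rank_smul_le c _

theorem MatrixLimit.isometry_star : Isometry (star : MatrixLimit n K → MatrixLimit n K) :=
  Isometry.of_dist_eq fun x y => by
    rw [MatrixLimit.dist_def, MatrixLimit.dist_def, ← star_sub, MatrixLimit.rank_star]

variable (n K) in
/-- The rank completion of the limit of the `M_{p m}(K)`: the completion with respect to the metric
`d(x, y) = rk(x - y)`. -/
abbrev RankCompletion : Type _ := UniformSpace.Completion (MatrixLimit n K)

/-- The involution is extended to the completion by continuity. -/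
instance : StarRing (RankCompletion n K) where
  star := UniformSpace.Completion.map star
  star_involutive x := by
    induction x using UniformSpace.Completion.induction_on with
    | hp =>
      exact isClosed_eq (UniformSpace.Completion.continuous_map.comp
        UniformSpace.Completion.continuous_map) continuous_id
    | ih x =>
      rw [UniformSpace.Completion.map_coe MatrixLimit.isometry_star.uniformContinuous,
        UniformSpace.Completion.map_coe MatrixLimit.isometry_star.uniformContinuous, star_star]
  star_mul x y := by
    induction x, y using UniformSpace.Completion.induction_on₂ with
    | hp =>
      have hc : Continuous (UniformSpace.Completion.map star :
        RankCompletion n K → RankCompletion n K) := UniformSpace.Completion.continuous_map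
      exact isClosed_eq (by fun_prop) (by fun_prop)
    | ih x y =>
      simp only [← UniformSpace.Completion.coe_mul,
        UniformSpace.Completion.map_coe MatrixLimit.isometry_star.uniformContinuous, star_mul]
  star_add x y := by
    induction x, y using UniformSpace.Completion.induction_on₂ with
    | hp =>
      have hc : Continuous (UniformSpace.Completion.map star :
        RankCompletion n K → RankCompletion n K) := UniformSpace.Completion.continuous_map
      exact isClosed_eq (by fun_prop) (by fun_prop)
    | ih x y =>
      simp only [← UniformSpace.Completion.coe_add,
        UniformSpace.Completion.map_coe MatrixLimit.isometry_star.uniformContinuous, star_add]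

theorem RankCompletion.star_coe (x : MatrixLimit n K) :
    star (x : RankCompletion n K) = (star x : MatrixLimit n K) :=
  UniformSpace.Completion.map_coe MatrixLimit.isometry_star.uniformContinuous x

instance : ContinuousStar (RankCompletion n K) where
  continuous_star := UniformSpace.Completion.continuous_map

theorem RankCompletion.star_algebraMap (r : K) :
    star (algebraMap K (RankCompletion n K) r) = algebraMap K (RankCompletion n K) (star r) := by
  rw [UniformSpace.Completion.algebraMap_def, RankCompletion.star_coe,
    UniformSpace.Completion.algebraMap_def, ← AlgHomClass.commutes (MatrixLimit.of n K 0),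
    ← map_star, ← AlgHomClass.commutes (MatrixLimit.of n K 0)]
  congr 2
  ext i j
  by_cases h : i = j
  · simp [Matrix.star_apply, Matrix.algebraMap_matrix_apply, h]
  · simp [Matrix.star_apply, Matrix.algebraMap_matrix_apply, h, Ne.symm h]

instance : StarModule K (RankCompletion n K) where
  star_smul r x := by
    rw [Algebra.smul_def, star_mul, RankCompletion.star_algebraMap, Algebra.smul_def,
      Algebra.commutes]
end Completion

/-! ### The odometer and its crossed product algebra -/
section Dynamics
variable (n : ℕ → ℕ) [∀ i, (n i).AtLeastTwo]

/-- The product of the finite discrete spaces `{0, …, n i - 1}`. -/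
abbrev Space : Type := ∀ i, Fin (n i)

variable {n}

/-- Addition of `(1, 0, 0, …)` with carry: the `i`-th digit is increased by one (cyclically) when
all the preceding digits are maximal, and is left unchanged otherwise. -/
def addOne (x : Space n) : Space n := fun i =>
  if ∀ j < i, (x j : ℕ) + 1 = n j then x i + 1 else x i

/-- The inverse of `addOne`. -/
def subOne (x : Space n) : Space n := fun i =>
  if ∀ j < i, (x j : ℕ) = 0 then x i - 1 else x i

theorem val_add_one (i : ℕ) (a : Fin (n i)) :
    ((a + 1 : Fin (n i)) : ℕ) = if (a : ℕ) + 1 = n i then 0 else (a : ℕ) + 1 := by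
  have h2 : 2 ≤ n i := Nat.AtLeastTwo.prop
  rw [Fin.val_add, Fin.val_one', Nat.mod_eq_of_lt (by omega : 1 < n i)]
  split_ifs with h
  · rw [h, Nat.mod_self]
  · exact Nat.mod_eq_of_lt (by omega)

theorem addOne_lt_zero_iff (x : Space n) (i : ℕ) :
    (∀ j < i, (addOne x j : ℕ) = 0) ↔ ∀ j < i, (x j : ℕ) + 1 = n j := by
  induction i with
  | zero => simp
  | succ i ih =>
    have hs (P : ℕ → Prop) : (∀ j < i + 1, P j) ↔ (∀ j < i, P j) ∧ P i := by
      constructor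
      · exact fun h => ⟨fun j hj => h j (by omega), h i (by omega)⟩
      · rintro ⟨h1, h2⟩ j hj
        rcases Nat.lt_succ_iff_lt_or_eq.mp hj with h | rfl
        exacts [h1 j h, h2]
    rw [hs, hs, ih]
    refine and_congr_right fun h => ?_
    rw [addOne, if_pos h, val_add_one]
    split_ifs <;> simp_all

theorem subOne_addOne (x : Space n) : subOne (addOne x) = x := by
  funext i
  rw [subOne]
  simp only [addOne_lt_zero_iff]
  split_ifs with h
  · rw [addOne, if_pos h, add_sub_cancel_right]
  · rw [addOne, if_neg h]

theorem subOne_lt_max_iff (x : Space n) (i : ℕ) :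
    (∀ j < i, (subOne x j : ℕ) + 1 = n j) ↔ ∀ j < i, (x j : ℕ) = 0 := by
  induction i with
  | zero => simp
  | succ i ih =>
    have hs (P : ℕ → Prop) : (∀ j < i + 1, P j) ↔ (∀ j < i, P j) ∧ P i := by
      constructor
      · exact fun h => ⟨fun j hj => h j (by omega), h i (by omega)⟩
      · rintro ⟨h1, h2⟩ j hj
        rcases Nat.lt_succ_iff_lt_or_eq.mp hj with h | rfl
        exacts [h1 j h, h2]
    rw [hs, hs, ih]
    refine and_congr_right fun h => ?_
    rw [subOne, if_pos h]
    have h1 := val_add_one i (x i - 1)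
    rw [sub_add_cancel] at h1
    rw [h1]
    split_ifs <;> simp_all

theorem addOne_subOne (x : Space n) : addOne (subOne x) = x := by
  funext i
  rw [addOne]
  simp only [subOne_lt_max_iff]
  split_ifs with h
  · rw [subOne, if_pos h, sub_add_cancel]
  · rw [subOne, if_neg h]

/-- A map `Space n → Space n` is continuous if each digit of the image is determined by finitely
many digits of the argument. -/
theorem continuous_of_digits {f : Space n → Space n}
    (h : ∀ i, ∃ g : (∀ j : Fin (i + 1), Fin (n j)) → Fin (n i), ∀ x, f x i = g fun j => x j) :
    Continuous f := by
  refine continuous_pi fun i => ?_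
  obtain ⟨g, hg⟩ := h i
  simp only [hg]
  exact continuous_of_discreteTopology.comp (continuous_pi fun j => continuous_apply (j : ℕ))

/-- The odometer homeomorphism. -/
def odometer : Space n ≃ₜ Space n where
  toFun := addOne
  invFun := subOne
  left_inv := subOne_addOne
  right_inv := addOne_subOne
  continuous_toFun := continuous_of_digits fun i =>
    ⟨fun y => if ∀ j : Fin (i + 1), (j : ℕ) < i → (y j : ℕ) + 1 = n j
      then (fun a : Fin (n i) => a + 1) (y (Fin.last i)) else y (Fin.last i), fun x => by
        have h : (∀ j < i, (x j : ℕ) + 1 = n j) ↔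
            ∀ j : Fin (i + 1), (j : ℕ) < i → (x j : ℕ) + 1 = n j :=
          ⟨fun h j hj => h j hj, fun h j hj => h ⟨j, by omega⟩ hj⟩
        rw [addOne]
        simp only [h]
        rfl⟩
  continuous_invFun := continuous_of_digits fun i =>
    ⟨fun y => if ∀ j : Fin (i + 1), (j : ℕ) < i → (y j : ℕ) = 0
      then (fun a : Fin (n i) => a - 1) (y (Fin.last i)) else y (Fin.last i), fun x => by
        have h : (∀ j < i, (x j : ℕ) = 0) ↔
            ∀ j : Fin (i + 1), (j : ℕ) < i → (x j : ℕ) = 0 :=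
          ⟨fun h j hj => h j hj, fun h j hj => h ⟨j, by omega⟩ hj⟩
        rw [subOne]
        simp only [h]
        rfl⟩

variable (n) (K : Type*) [Field K] [StarRing K]

/-- The algebra of locally constant functions, with pointwise involution. -/
abbrev Functions : Type _ := LocallyConstant (Space n) K

instance : StarRing (Functions n K) where
  star f := f.map star
  star_involutive f := by ext x; exact star_star _
  star_mul f g := by ext x; exact star_mul _ _
  star_add f g := by ext x; exact star_add _ _

/-- `ℤ` acts on the locally constant functions by `k • f = f ∘ T⁻ᵏ`. -/
instance : MulSemiringAction (Multiplicative ℤ) (Functions n K) where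
  smul k f := f.comap ((odometer ^ (-k.toAdd) : Space n ≃ₜ Space n) : C(Space n, Space n))
  one_smul f := by
    ext x
    change f ((odometer ^ (-0 : ℤ) : Space n ≃ₜ Space n) x) = f x
    rw [neg_zero, zpow_zero]
    rfl
  mul_smul k l f := by
    ext x
    change f ((odometer ^ (-(k.toAdd + l.toAdd)) : Space n ≃ₜ Space n) x) =
      f ((odometer ^ (-l.toAdd) : Space n ≃ₜ Space n)
        ((odometer ^ (-k.toAdd) : Space n ≃ₜ Space n) x))
    rw [neg_add_rev, zpow_add]
    rfl
  smul_zero k := by ext x; rfl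
  smul_add k f g := by ext x; rfl
  smul_one k := by ext x; rfl
  smul_mul k f g := by ext x; rfl

variable {n K} in
theorem smul_apply (k : Multiplicative ℤ) (f : Functions n K) (x : Space n) :
    (k • f) x = f ((odometer ^ (-k.toAdd) : Space n ≃ₜ Space n) x) := rfl

instance : SMulCommClass (Multiplicative ℤ) K (Functions n K) where
  smul_comm k r f := by ext x; rfl

theorem star_smul_functions (k : Multiplicative ℤ) (f : Functions n K) :
    star (k • f) = k • star f := by ext x; rfl

/-- The generalized odometer algebra `C_K(X) ⋊_T ℤ`: finite sums `∑ f_k t^k` with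
`t f = (f ∘ T⁻¹) t`. -/
abbrev OdometerAlgebra : Type _ := SkewMonoidAlgebra (Functions n K) (Multiplicative ℤ)

/-- The involution `(∑ f_k t^k)^* = ∑ t^{-k} (f_k)^*`, as an additive map. -/
def starAddHom : OdometerAlgebra n K →+ OdometerAlgebra n K :=
  SkewMonoidAlgebra.coeffAddEquiv.symm.toAddMonoidHom.comp <|
  (Finsupp.liftAddHom fun k : Multiplicative ℤ =>
    { toFun := fun f => (Finsupp.single k⁻¹ (k⁻¹ • star f) : Multiplicative ℤ →₀ Functions n K)
      map_zero' := by simp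
      map_add' := fun f g => by simp }).comp
  SkewMonoidAlgebra.coeffAddEquiv.toAddMonoidHom

theorem starAddHom_single (k : Multiplicative ℤ) (f : Functions n K) :
    starAddHom n K (SkewMonoidAlgebra.single k f) =
      SkewMonoidAlgebra.single k⁻¹ (k⁻¹ • star f) := by
  simp [starAddHom, SkewMonoidAlgebra.coeffAddEquiv]

instance : StarRing (OdometerAlgebra n K) where
  star := starAddHom n K
  star_involutive a := by
    induction a using SkewMonoidAlgebra.induction_on' with
    | single k f =>
      rw [starAddHom_single, starAddHom_single, star_smul_functions, star_star, inv_inv,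
        smul_inv_smul]
    | add a b ha hb => rw [map_add, map_add, ha, hb]
  star_mul a b := by
    induction a using SkewMonoidAlgebra.induction_on' with
    | add a a' ha hb => rw [add_mul, map_add, map_add, mul_add, ha, hb]
    | single k f =>
      induction b using SkewMonoidAlgebra.induction_on' with
      | add b b' ha hb => rw [mul_add, map_add, map_add, add_mul, ha, hb]
      | single l g =>
        rw [SkewMonoidAlgebra.single_mul_single, starAddHom_single, starAddHom_single,
          starAddHom_single, SkewMonoidAlgebra.single_mul_single, star_mul, smul_mul',
          star_smul_functions, smul_smul, smul_smul, mul_inv_rev, inv_mul_cancel_right, mul_comm]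
  star_add a b := map_add _ a b

theorem star_single (k : Multiplicative ℤ) (f : Functions n K) :
    star (SkewMonoidAlgebra.single k f : OdometerAlgebra n K) =
      SkewMonoidAlgebra.single k⁻¹ (k⁻¹ • star f) :=
  starAddHom_single n K k f
end Dynamics

/-! ### The representation of the odometer algebra on the rank completion -/
section Representation
variable {n : ℕ → ℕ} [∀ i, (n i).AtLeastTwo] {K : Type*} [Field K] [StarRing K]

theorem add_one_mod (a i : ℕ) :
    (a + 1) % n i = if a % n i + 1 = n i then 0 else a % n i + 1 := by
  have h2 : 2 ≤ n i := Nat.AtLeastTwo.prop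
  have h3 : a % n i < n i := Nat.mod_lt _ (by omega)
  rw [Nat.add_mod, Nat.mod_eq_of_lt (by omega : 1 < n i)]
  split_ifs with h
  · rw [h, Nat.mod_self]
  · exact Nat.mod_eq_of_lt (by omega)

theorem p_dvd_succ_iff (k i : ℕ) :
    p n i ∣ k + 1 ↔ ∀ j < i, k / p n j % n j + 1 = n j := by
  induction i with
  | zero => simp [p]
  | succ i ih =>
    have hs (P : ℕ → Prop) : (∀ j < i + 1, P j) ↔ (∀ j < i, P j) ∧ P i := by
      constructor
      · exact fun h => ⟨fun j hj => h j (by omega), h i (by omega)⟩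
      · rintro ⟨h1, h2⟩ j hj
        rcases Nat.lt_succ_iff_lt_or_eq.mp hj with h | rfl
        exacts [h1 j h, h2]
    rw [hs, ← ih, p]
    constructor
    · intro h
      have h1 : p n i ∣ k + 1 := (Dvd.intro_left _ rfl).trans h
      refine ⟨h1, ?_⟩
      rw [mul_comm] at h
      have h2 := (Nat.dvd_div_iff_mul_dvd h1).mpr h
      rw [Nat.succ_div_of_dvd h1, Nat.dvd_iff_mod_eq_zero, add_one_mod] at h2
      by_contra h3
      simp [h3] at h2
    · rintro ⟨h1, h2⟩
      rw [mul_comm, ← Nat.dvd_div_iff_mul_dvd h1, Nat.succ_div_of_dvd h1,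
        Nat.dvd_iff_mod_eq_zero, add_one_mod, if_pos h2]

/-- The digits of the points in the forward orbit of zero. -/
theorem orbit_digit (k i : ℕ) :
    (((odometer ^ k : Space n ≃ₜ Space n) 0 i : Fin (n i)) : ℕ) = k / p n i % n i := by
  induction k generalizing i with
  | zero => simp
  | succ k ih =>
    rw [pow_succ']
    change ((addOne ((odometer ^ k : Space n ≃ₜ Space n) 0) i : Fin (n i)) : ℕ) = _
    rw [addOne]
    simp only [ih, ← p_dvd_succ_iff]
    split_ifs with h
    · rw [val_add_one, ih, Nat.succ_div_of_dvd h, add_one_mod]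
    · rw [ih, Nat.succ_div_of_not_dvd h]

/-- `f` depends only on the first `m` digits. -/
def IsLevel {K : Type*} (m : ℕ) (f : LocallyConstant (Space n) K) : Prop := ∀ x y, (∀ i < m, x i = y i) → f x = f y

theorem p_dvd_p {i m : ℕ} (h : i < m) : p n (i + 1) ∣ p n m := by
  induction h with
  | refl => exact dvd_rfl
  | step h ih => exact ih.trans (Dvd.intro_left _ rfl)

theorem IsLevel.mono {m m' : ℕ} (h : m ≤ m') {f : LocallyConstant (Space n) K} (hf : IsLevel m f) :
    IsLevel m' f := fun x y hxy => hf x y fun i hi => hxy i (hi.trans_le h)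

theorem exists_isLevel (f : LocallyConstant (Space n) K) : ∃ m, IsLevel m f := by
  have h1 (x : Space n) : ∃ m, ∀ y ∈ PiNat.cylinder x m, f y = f x := by
    obtain ⟨_, ⟨z, m, rfl⟩, hx, hm⟩ :=
      (PiNat.isTopologicalBasis_cylinders fun i => Fin (n i)).exists_subset_of_mem_open
        (show x ∈ f ⁻¹' {f x} from rfl) (f.isLocallyConstant.isOpen_fiber (f x))
    rw [← PiNat.mem_cylinder_iff_eq.mp hx] at hm
    exact ⟨m, fun y hy => hm hy⟩
  choose m hm using h1
  obtain ⟨t, ht⟩ := isCompact_univ.elim_finite_subcover (fun x => PiNat.cylinder x (m x))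
    (fun x => PiNat.isOpen_cylinder _ x (m x))
    (fun x _ => Set.mem_iUnion.mpr ⟨x, PiNat.self_mem_cylinder x (m x)⟩)
  refine ⟨t.sup m, fun y z hyz => ?_⟩
  obtain ⟨x, hx, hy⟩ := Set.mem_iUnion₂.mp (ht (Set.mem_univ y))
  have hz : z ∈ PiNat.cylinder x (m x) := fun i hi => by
    rw [← hyz i (hi.trans_le (Finset.le_sup hx))]
    exact hy i hi
  rw [hm x y hy, hm x z hz]

/-- The diagonal matrix with entries `f (T ^ a 0)`, `0 ≤ a < p m`. -/
def diagonal (m : ℕ) (f : Functions n K) : Matrix (Fin (p n m)) (Fin (p n m)) K :=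
  Matrix.diagonal fun a => f ((odometer ^ (a : ℕ) : Space n ≃ₜ Space n) 0)

theorem constStep_apply (m : ℕ) (x : Matrix (Fin (p n m)) (Fin (p n m)) K)
    (a b : Fin (p n (m + 1))) : constStep n K m x a b =
      if (a : ℕ) / p n m = b / p n m
        then x ⟨a % p n m, Nat.mod_lt _ (p_pos n m)⟩ ⟨b % p n m, Nat.mod_lt _ (p_pos n m)⟩
        else 0 := by
  have h : constStep n K m x a b = algebraMap K (Matrix (Fin (n m)) (Fin (n m)) K)
      (x ⟨a % p n m, Nat.mod_lt _ (p_pos n m)⟩ ⟨b % p n m, Nat.mod_lt _ (p_pos n m)⟩)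
      (Fin.divNat (n := p n m) (m := n m) a) (Fin.divNat (n := p n m) (m := n m) b) := rfl
  rw [h, Matrix.algebraMap_matrix_apply]
  exact if_congr Fin.ext_iff rfl rfl

theorem constStep_diagonal {m : ℕ} {f : Functions n K} (hf : IsLevel m f) :
    constStep n K m (diagonal m f) = diagonal (m + 1) f := by
  have hval (a : Fin (p n (m + 1))) :
      f ((odometer ^ ((a : ℕ) % p n m) : Space n ≃ₜ Space n) 0) =
        f ((odometer ^ (a : ℕ) : Space n ≃ₜ Space n) 0) := by
    refine hf _ _ fun i hi => Fin.ext ?_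
    obtain ⟨c, hc⟩ := p_dvd_p (n := n) hi
    rw [orbit_digit, orbit_digit]
    rw [hc, show p n (i + 1) = n i * p n i from rfl, mul_comm (n i), mul_assoc, Nat.mod_mul_right_div_self, Nat.mod_mul_right_mod]
  ext a b
  rw [constStep_apply]
  simp only [diagonal, Matrix.diagonal_apply, Fin.ext_iff, ← hval]
  have h1 := Nat.div_add_mod (a : ℕ) (p n m)
  have h2 := Nat.div_add_mod (b : ℕ) (p n m)
  split_ifs with h3 h4 h5 h6 h7
  · rfl
  · rw [h3, h4] at h1
    omega
  · rw [h6] at h4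
    exact absurd rfl h4
  · rfl
  · rw [h7] at h3
    exact absurd rfl h3
  · rfl

open Classical in
/-- The embedding of `C_K(X)` into the limit of the `M_{p m}(K)`: a function that depends on the
first `m` digits only is sent to the class of the diagonal matrix of its values at
`0, T 0, …, T ^ (p m - 1) 0`. In particular the characteristic function of `T ^ a [0 … 0]` goes to
the matrix unit in position `(a, a)`. -/
def diagonalFun (f : Functions n K) : MatrixLimit n K :=
  MatrixLimit.of n K (Nat.find (exists_isLevel f)) (diagonal _ f)

theorem diagonalFun_eq {m : ℕ} {f : Functions n K} (hf : IsLevel m f) :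
    diagonalFun f = MatrixLimit.of n K m (diagonal m f) := by
  classical
  have h : Nat.find (exists_isLevel f) ≤ m := Nat.find_min' _ hf
  rw [diagonalFun]
  induction h with
  | refl => rfl
  | @step k h ih =>
    have hk := (Nat.find_spec (exists_isLevel f)).mono h
    rw [ih hk, ← constStep_diagonal hk, MatrixLimit.of_succ]

theorem exists_isLevel₂ (f g : LocallyConstant (Space n) K) : ∃ m, IsLevel m f ∧ IsLevel m g := by
  obtain ⟨k, hk⟩ := exists_isLevel f
  obtain ⟨l, hl⟩ := exists_isLevel g
  exact ⟨max k l, hk.mono (le_max_left _ _), hl.mono (le_max_right _ _)⟩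

variable (n K) in
/-- `diagonalFun` as a `*`-homomorphism. -/
def diagonalHom : Functions n K →⋆ₐ[K] MatrixLimit n K where
  toFun := diagonalFun
  map_one' := by
    rw [diagonalFun_eq (m := 0) fun _ _ _ => rfl, ← map_one (MatrixLimit.of n K 0)]
    congr 1
  map_mul' f g := by
    obtain ⟨m, hf, hg⟩ := exists_isLevel₂ f g
    have h : IsLevel m (f * g) := fun x y hxy => congrArg₂ (· * ·) (hf x y hxy) (hg x y hxy)
    rw [diagonalFun_eq hf, diagonalFun_eq hg, diagonalFun_eq h, ← map_mul]
    congr 1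
    exact (Matrix.diagonal_mul_diagonal _ _).symm
  map_zero' := by
    rw [diagonalFun_eq (m := 0) fun _ _ _ => rfl, ← map_zero (MatrixLimit.of n K 0)]
    congr 1
    exact Matrix.diagonal_zero
  map_add' f g := by
    obtain ⟨m, hf, hg⟩ := exists_isLevel₂ f g
    have h : IsLevel m (f + g) := fun x y hxy => congrArg₂ (· + ·) (hf x y hxy) (hg x y hxy)
    rw [diagonalFun_eq hf, diagonalFun_eq hg, diagonalFun_eq h, ← map_add]
    congr 1
    exact (Matrix.diagonal_add _ _).symm
  commutes' r := by
    rw [diagonalFun_eq (m := 0) fun _ _ _ => rfl, ← AlgHomClass.commutes (MatrixLimit.of n K 0)]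
    congr 1
  map_star' f := by
    obtain ⟨m, hf⟩ := exists_isLevel f
    have h : IsLevel m (star f) := fun x y hxy => congrArg star (hf x y hxy)
    rw [diagonalFun_eq hf, diagonalFun_eq h, ← map_star]
    congr 1
    exact (Matrix.diagonal_conjTranspose _).symm

variable (n K) in
/-- The matrix `e_{10} + e_{21} + ⋯` in `M_{p m}(K)`; it represents the element `χ t`, `χ` the
characteristic function of the complement of the cylinder set `[0 … 0]` of length `m`. -/
def shift (m : ℕ) : Matrix (Fin (p n m)) (Fin (p n m)) K :=
  Matrix.of fun a b => if (a : ℕ) = b + 1 then 1 else 0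

theorem rank_of_le {m : ℕ} (x : Matrix (Fin (p n m)) (Fin (p n m)) K)
    (s : Finset (Fin (p n m))) (k : ℕ) (hs : s.card ≤ k) (hx : ∀ a ∉ s, ∀ b, x a b = 0) :
    (MatrixLimit.of n K m x).rank ≤ k / p n m := by
  rw [MatrixLimit.rank_of]
  gcongr
  refine (Matrix.rank_le_card_of_support_subset x s fun a ha => ?_).trans hs
  by_contra h
  exact ha (funext fun b => hx a h b)

theorem one_div_p_le (m : ℕ) : (1 : ℝ) / p n m ≤ (1 / 2) ^ m := by
  rw [one_div_pow]
  gcongr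
  exact_mod_cast two_pow_le_p n m

theorem dist_shift (m : ℕ) : dist (MatrixLimit.of n K m (shift n K m))
    (MatrixLimit.of n K (m + 1) (shift n K (m + 1))) ≤ 1 * (1 / 2) ^ m := by
  rw [← MatrixLimit.of_succ, MatrixLimit.dist_def, ← map_sub, one_mul]
  refine le_trans ?_ (one_div_p_le (n := n) m)
  have h2 : (n m : ℝ) ≠ 0 := Nat.cast_ne_zero.mpr (NeZero.ne (n m))
  have h3 : (n m : ℝ) / p n (m + 1) = 1 / p n m := by
    rw [show p n (m + 1) = n m * p n m from rfl, Nat.cast_mul, div_mul_cancel_left₀ h2, one_div]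
  rw [← h3]
  refine rank_of_le (n := n) (K := K) (m := m + 1) _ (Finset.univ.image fun i : Fin (n m) =>
    (show Fin (p n (m + 1)) from finProdFinEquiv (i, (⟨0, p_pos n m⟩ : Fin (p n m))))) _
    (Finset.card_image_le.trans (Finset.card_fin _).le) fun a ha b => ?_
  have h0 : (a : ℕ) % p n m ≠ 0 := by
    intro h0
    refine ha (Finset.mem_image.mpr ⟨Fin.divNat (n := p n m) (m := n m) a, Finset.mem_univ _, ?_⟩)
    refine Fin.ext ?_
    change 0 + p n m * ((a : ℕ) / p n m) = a
    rw [zero_add, ← Nat.div_add_mod (a : ℕ) (p n m), h0]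
    simp [p_pos n m]
  rw [Matrix.sub_apply, constStep_apply, shift, shift, Matrix.of_apply, Matrix.of_apply]
  simp only
  have h4 := Nat.div_add_mod (a : ℕ) (p n m)
  have h5 := Nat.div_add_mod (b : ℕ) (p n m)
  by_cases h : (a : ℕ) = b + 1
  · have h6 : ¬ p n m ∣ (b : ℕ) + 1 := by
      rw [← h, Nat.dvd_iff_mod_eq_zero]; exact h0
    have h7 : (a : ℕ) / p n m = b / p n m := by rw [h, Nat.succ_div_of_not_dvd h6]
    have h8 : (a : ℕ) % p n m = b % p n m + 1 := by
      rw [h7] at h4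
      omega
    rw [if_pos h7, if_pos h8, if_pos h, sub_self]
  · rw [if_neg h, sub_zero]
    split_ifs with h7 h8
    · rw [h7, h8] at h4
      omega
    · rfl
    · rfl

theorem dist_star_mul_shift (m : ℕ) :
    dist (MatrixLimit.of n K m (star (shift n K m) * shift n K m)) 1 ≤ (1 / 2) ^ m := by
  rw [← map_one (MatrixLimit.of n K m), MatrixLimit.dist_def, ← map_sub]
  refine le_trans ?_ (one_div_p_le (n := n) m)
  have hp := p_pos n m
  rw [show (1 : ℝ) = ((1 : ℕ) : ℝ) from Nat.cast_one.symm]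
  refine rank_of_le (n := n) (K := K) (m := m) _ {⟨p n m - 1, by omega⟩} 1 (Finset.card_singleton _).le fun a ha b => ?_
  have ha' : (a : ℕ) + 1 < p n m := by
    by_contra h
    exact ha (Finset.mem_singleton.mpr (Fin.ext (by simp only; omega)))
  rw [Matrix.sub_apply, Matrix.mul_apply, Finset.sum_eq_single ⟨a + 1, ha'⟩]
  · simp [shift, Matrix.star_apply, Matrix.one_apply, Fin.ext_iff]
  · intro c _ hc
    have : ¬ (c : ℕ) = a + 1 := fun h => hc (Fin.ext h)
    simp [shift, Matrix.star_apply, this]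
  · simp

theorem dist_shift_mul_star (m : ℕ) :
    dist (MatrixLimit.of n K m (shift n K m * star (shift n K m))) 1 ≤ (1 / 2) ^ m := by
  rw [← map_one (MatrixLimit.of n K m), MatrixLimit.dist_def, ← map_sub]
  refine le_trans ?_ (one_div_p_le (n := n) m)
  have hp := p_pos n m
  rw [show (1 : ℝ) = ((1 : ℕ) : ℝ) from Nat.cast_one.symm]
  refine rank_of_le (n := n) (K := K) (m := m) _ {⟨0, hp⟩} 1 (Finset.card_singleton _).le fun a ha b => ?_
  have ha' : (a : ℕ) ≠ 0 := fun h => ha (Finset.mem_singleton.mpr (Fin.ext h))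
  rw [Matrix.sub_apply, Matrix.mul_apply, Finset.sum_eq_single ⟨a - 1, by omega⟩]
  · have h1 : (a : ℕ) = a - 1 + 1 := by omega
    simp only [shift, Matrix.star_apply, Matrix.one_apply, Fin.ext_iff, Matrix.of_apply, ← h1]
    by_cases h2 : (a : ℕ) = b
    · simp [h2]
    · simp [h2, Ne.symm h2]
  · intro c _ hc
    have : ¬ (a : ℕ) = c + 1 := fun h => hc (Fin.ext (by simp only; omega))
    simp [shift, this]
  · simp

variable (n K) in
/-- The limit in the rank completion of the matrices `e_{10} + e_{21} + ⋯`. -/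
def shiftLimit : RankCompletion n K :=
  Filter.limUnder Filter.atTop fun m => (MatrixLimit.of n K m (shift n K m) : RankCompletion n K)

theorem tendsto_shift : Filter.Tendsto
    (fun m => (MatrixLimit.of n K m (shift n K m) : RankCompletion n K)) Filter.atTop
    (nhds (shiftLimit n K)) := by
  refine CauchySeq.tendsto_limUnder (cauchySeq_of_le_geometric (1 / 2) 1 (by norm_num) fun m => ?_)
  rw [UniformSpace.Completion.dist_eq]
  exact dist_shift m

theorem star_mul_shiftLimit : star (shiftLimit n K) * shiftLimit n K = 1 := by
  have h1 := (tendsto_shift (n := n) (K := K)).star.mul (tendsto_shift (n := n) (K := K))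
  refine tendsto_nhds_unique h1 ?_
  rw [tendsto_iff_dist_tendsto_zero]
  refine squeeze_zero (fun _ => dist_nonneg) (fun m => ?_)
    (tendsto_pow_atTop_nhds_zero_of_lt_one (r := (1 / 2 : ℝ)) (by norm_num) (by norm_num))
  rw [RankCompletion.star_coe, ← UniformSpace.Completion.coe_mul,
    ← UniformSpace.Completion.coe_one, UniformSpace.Completion.dist_eq, ← map_star, ← map_mul]
  exact dist_star_mul_shift m

theorem shiftLimit_mul_star : shiftLimit n K * star (shiftLimit n K) = 1 := by
  have h1 := (tendsto_shift (n := n) (K := K)).mul (tendsto_shift (n := n) (K := K)).star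
  refine tendsto_nhds_unique h1 ?_
  rw [tendsto_iff_dist_tendsto_zero]
  refine squeeze_zero (fun _ => dist_nonneg) (fun m => ?_)
    (tendsto_pow_atTop_nhds_zero_of_lt_one (r := (1 / 2 : ℝ)) (by norm_num) (by norm_num))
  rw [RankCompletion.star_coe, ← UniformSpace.Completion.coe_mul,
    ← UniformSpace.Completion.coe_one, UniformSpace.Completion.dist_eq, ← map_star, ← map_mul]
  exact dist_shift_mul_star m

variable (n K) in
/-- `shiftLimit` as a unit. -/
def shiftUnit : (RankCompletion n K)ˣ where
  val := shiftLimit n K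
  inv := star (shiftLimit n K)
  val_inv := shiftLimit_mul_star
  inv_val := star_mul_shiftLimit

theorem shiftLimit_mul_diagonal (f : Functions n K) :
    shiftLimit n K * (diagonalFun f : RankCompletion n K) =
      (diagonalFun (Multiplicative.ofAdd (1 : ℤ) • f) : RankCompletion n K) * shiftLimit n K := by
  have h1 := (tendsto_shift (n := n) (K := K)).mul_const (diagonalFun f : RankCompletion n K)
  have h2 := (tendsto_shift (n := n) (K := K)).const_mul
    (diagonalFun (Multiplicative.ofAdd (1 : ℤ) • f) : RankCompletion n K)
  refine tendsto_nhds_unique h1 (h2.congr' ?_)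
  obtain ⟨m₀, hf, hg⟩ := exists_isLevel₂ f (Multiplicative.ofAdd (1 : ℤ) • f)
  filter_upwards [Filter.eventually_ge_atTop m₀] with m hm
  rw [← UniformSpace.Completion.coe_mul, ← UniformSpace.Completion.coe_mul,
    diagonalFun_eq (hf.mono hm), diagonalFun_eq (hg.mono hm), ← map_mul, ← map_mul]
  congr 2
  ext a b
  rw [diagonal, diagonal, Matrix.diagonal_mul, Matrix.mul_diagonal, shift, Matrix.of_apply]
  split_ifs with h
  · rw [one_mul, mul_one, smul_apply, h, pow_succ']
    change f ((odometer ^ (-1 : ℤ) : Space n ≃ₜ Space n)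
      (odometer ((odometer ^ (b : ℕ) : Space n ≃ₜ Space n) 0))) = _
    rw [zpow_neg_one]
    exact congrArg f (odometer.symm_apply_apply _)
  · simp

theorem shiftUnit_zpow_mul_diagonal (k : Multiplicative ℤ) (f : Functions n K) :
    ((shiftUnit n K ^ k.toAdd : (RankCompletion n K)ˣ) : RankCompletion n K) *
        (diagonalFun f : RankCompletion n K) =
      (diagonalFun (k • f) : RankCompletion n K) *
        ((shiftUnit n K ^ k.toAdd : (RankCompletion n K)ˣ) : RankCompletion n K) := by
  obtain ⟨k, rfl⟩ := Multiplicative.ofAdd.surjective k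
  rw [toAdd_ofAdd]
  have h1 (f : Functions n K) : (shiftUnit n K : RankCompletion n K) * diagonalFun f =
      diagonalFun (Multiplicative.ofAdd (1 : ℤ) • f) * (shiftUnit n K : RankCompletion n K) :=
    shiftLimit_mul_diagonal f
  induction k generalizing f with
  | zero => simp
  | succ k ih =>
    rw [zpow_add_one, Units.val_mul, mul_assoc, h1, ← mul_assoc, ih, mul_assoc, ofAdd_add,
      mul_smul]
  | pred k ih =>
    rw [zpow_sub_one, Units.val_mul, mul_assoc]
    have h2 : ((shiftUnit n K)⁻¹ : (RankCompletion n K)ˣ) * (diagonalFun f : RankCompletion n K) =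
        (diagonalFun ((Multiplicative.ofAdd (1 : ℤ))⁻¹ • f) : RankCompletion n K) *
          ((shiftUnit n K)⁻¹ : (RankCompletion n K)ˣ) := by
      rw [Units.inv_mul_eq_iff_eq_mul, ← mul_assoc, h1, smul_inv_smul, Units.mul_inv_cancel_right]
    rw [h2, ← mul_assoc, ih, mul_assoc, ofAdd_sub, div_eq_mul_inv, mul_smul]

variable (n K) in
/-- `diagonalHom`, considered as a map to the rank completion. -/
def functionsHom : Functions n K →⋆ₐ[K] RankCompletion n K where
  __ := (UniformSpace.Completion.coeRingHom : MatrixLimit n K →+* RankCompletion n K).comp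
    (diagonalHom n K : Functions n K →+* MatrixLimit n K)
  commutes' r := congrArg (fun x : MatrixLimit n K => (x : RankCompletion n K))
    (AlgHomClass.commutes (diagonalHom n K) r)
  map_star' f := (congrArg (fun x : MatrixLimit n K => (x : RankCompletion n K))
    (map_star (diagonalHom n K) f)).trans (RankCompletion.star_coe _).symm

variable (n K) in
/-- The homomorphism of algebras `∑ f_k t^k ↦ ∑ π(f_k) u^k` from the odometer algebra to the rank
completion, where `π = functionsHom` and `u = shiftUnit`. -/
def representationAlgHom : OdometerAlgebra n K →ₐ[K] RankCompletion n K :=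
  SkewMonoidAlgebra.liftNCAlgHom (functionsHom n K : Functions n K →ₐ[K] RankCompletion n K)
    ((Units.coeHom _).comp (zpowersHom _ (shiftUnit n K)))
    fun {f k} => (shiftUnit_zpow_mul_diagonal k f).symm

theorem representationAlgHom_single (k : Multiplicative ℤ) (f : Functions n K) :
    representationAlgHom n K (SkewMonoidAlgebra.single k f) = functionsHom n K f *
      ((shiftUnit n K ^ k.toAdd : (RankCompletion n K)ˣ) : RankCompletion n K) :=
  SkewMonoidAlgebra.liftNC_single _ _ _ _

variable (n K) in
/-- The canonical `*`-homomorphism from the odometer algebra to the rank completion: it is given by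
`functionsHom` on `C_K(X)` and sends `t` to `lim (e_{10} + e_{21} + ⋯)`. -/
def representation : OdometerAlgebra n K →⋆ₐ[K] RankCompletion n K where
  __ := representationAlgHom n K
  map_star' a := by
    change representationAlgHom n K (star a) = star (representationAlgHom n K a)
    induction a using SkewMonoidAlgebra.induction_on' with
    | add a b ha hb => rw [star_add, map_add, map_add, ha, hb, star_add]
    | single k f =>
      have hU : star (shiftUnit n K) = (shiftUnit n K)⁻¹ := Units.ext rfl
      have h := shiftUnit_zpow_mul_diagonal k⁻¹ (star f)
      rw [star_single, representationAlgHom_single, representationAlgHom_single, star_mul,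
        ← Units.coe_star, star_zpow, hU, ← map_star, inv_zpow']
      exact h.symm

/-- The value of the representation on the generator `t` of `ℤ`. -/
theorem representation_t : representation n K
    (SkewMonoidAlgebra.single (Multiplicative.ofAdd (1 : ℤ)) 1) = shiftLimit n K := by
  have h := representationAlgHom_single (n := n) (K := K) (Multiplicative.ofAdd (1 : ℤ)) 1
  rw [map_one (functionsHom n K), one_mul, toAdd_ofAdd, zpow_one] at h
  exact h

/-- The value of the representation on a function that depends on the first `m` digits only. -/
theorem representation_functions {m : ℕ} {f : Functions n K} (hf : IsLevel m f) :
    representation n K (SkewMonoidAlgebra.single 1 f) =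
      (MatrixLimit.of n K m (diagonal m f) : RankCompletion n K) := by
  have h := representationAlgHom_single (n := n) (K := K) 1 f
  rw [toAdd_one, zpow_zero, Units.val_one, mul_one] at h
  rw [← diagonalFun_eq hf]
  exact h

end Representation

/-! ### The `*`-regular closure -/
section Regular

/-- A `*`-regular ring: von Neumann regular, with a proper involution. -/
def IsStarRegular (R : Type*) [Ring R] [StarRing R] : Prop :=
  (∀ x : R, ∃ y, x * y * x = x) ∧ ∀ x : R, star x * x = 0 → x = 0

/-- The `*`-regular closure of `S` in `R`: the intersection of all unital `*`-subalgebras of `R` which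
contain `S` and are `*`-regular rings. (If `S` contains the scalars, as below, unital `*`-subrings
containing `S` are subalgebras.) -/
def starRegularClosure (K : Type*) {R : Type*} [Field K] [StarRing K] [Ring R] [StarRing R]
    [Algebra K R] [StarModule K R] (S : Set R) : StarSubalgebra K R :=
  sInf {B | IsStarRegular B ∧ S ⊆ B}

/-- The involution of `K` is positive definite. -/
def IsPositiveDefinite (K : Type*) [Field K] [StarRing K] : Prop :=
  ∀ (k : ℕ) (a : Fin k → K), ∑ i, star (a i) * a i = 0 → ∀ i, a i = 0

end Regular

end Odometer
end

/-!
Let `u` be the image of `t` in the rank completion (`shiftUnit`), the limit of the nilpotent shift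
matrices `S_m`. The direct limit of the algebras `M_{p m}(K(t ^ p m))` embeds into the rank
completion (`limitHom`), and the range of this embedding is the `*`-regular closure
(`starRegularClosure_eq_range`).

*Construction of the embedding.* A polynomial with non-zero constant term takes invertible values at
every `S_m`, and inversion does not increase rank distances, so its value at `u` is invertible as a
limit of invertible elements (`isUnit_of_tendsto`). As `u` is itself a unit, all non-zero
polynomials in `u` are invertible (`isUnit_aeval_shiftLimit`), and `t ^ p m ↦ u ^ p m` extends to
`K(t ^ p m)` (`scalarHom`). Since `S_m` is a compression of `u` on both sides
(`levelHom_mul_shiftLimit`, `shiftLimit_mul_levelHom`), the matrix units of `M_{p m}(K)` are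
`e_{ij} = uⁱ e_{00} (u^*)ʲ` (`levelHom_single`), and they commute with `u ^ p m`
(`commute_shiftUnit_pow_levelHom`). This gives homomorphisms on `M_{p m}(K(t ^ p m))`
(`rationalLevelHom`). They are compatible with the connecting maps (`rationalLevelHom_step`),
because the companion matrix of size `p m`, whose power with exponent `p m` is the scalar `t ^ p m`,
goes to `u` at every level and to the companion matrix of the next level. The limit homomorphism is
injective since matrix rings over a field are simple.

*Identification of the range.* The range contains the image of the odometer algebra, and it is von
Neumann regular because matrix rings over a field are. Its involution is proper because that of the
rank completion is (`eq_zero_of_star_mul_self`): `rk (x^* x) = rk x` holds for matrices by positive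
definiteness and extends by continuity. Conversely, a `*`-regular subalgebra containing the image of
the odometer algebra contains `u`, the projections `e_{00}`, and the inverses of the non-zero
Laurent polynomials in `u`, as a generalized inverse of an invertible element is its inverse
(`scalarHom_mem`); hence it contains the range (`range_le_of_isStarRegular`).
-/

noncomputable section

open scoped LaurentPolynomial

set_option linter.unusedSectionVars false

namespace Odometer

/-! ### Evaluation of rational functions at a unit of a noncommutative algebra -/
section Evaluation
variable {K : Type*} [Field K] {A : Type*} [Ring A] [Algebra K A]

/-- Evaluation of Laurent polynomials at a unit of an algebra that need not be commutative. -/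
def laurentEval (v : Aˣ) : K[T;T⁻¹] →ₐ[K] A :=
  AddMonoidAlgebra.lift K _ ℤ ((Units.coeHom _).comp (zpowersHom _ v))

theorem laurentEval_T (v : Aˣ) (k : ℤ) :
    laurentEval (K := K) v (LaurentPolynomial.T k) = ((v ^ k : Aˣ) : A) := by
  rw [LaurentPolynomial.T, laurentEval, AddMonoidAlgebra.lift_single, one_smul]
  simp

theorem laurentEval_C_mul_T (v : Aˣ) (a : K) (k : ℤ) :
    laurentEval v (LaurentPolynomial.C a * LaurentPolynomial.T k) =
      a • ((v ^ k : Aˣ) : A) := by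
  rw [map_mul, laurentEval_T, LaurentPolynomial.C_eq_algebraMap, AlgHom.commutes,
    Algebra.smul_def]

theorem laurentEval_toLaurent (v : Aˣ) (f : Polynomial K) :
    laurentEval v (Polynomial.toLaurent f) = Polynomial.aeval (v : A) f := by
  have h : (laurentEval (K := K) v).comp Polynomial.toLaurentAlg =
      Polynomial.aeval (v : A) := by
    refine Polynomial.algHom_ext ?_
    rw [AlgHom.comp_apply, Polynomial.toLaurentAlg_apply, Polynomial.toLaurent_X,
      laurentEval_T, zpow_one, Polynomial.aeval_X]
  rw [← h, AlgHom.comp_apply, Polynomial.toLaurentAlg_apply]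

theorem commute_laurentEval {v : Aˣ} {x : A} (h : Commute (v : A) x) (f : K[T;T⁻¹]) :
    Commute (laurentEval v f) x := by
  induction f using LaurentPolynomial.induction_on' with
  | add f g hf hg => rw [map_add]; exact hf.add_left hg
  | C_mul_T k a =>
    rw [laurentEval_C_mul_T]
    exact (h.units_zpow_left k).smul_left a

theorem laurentEval_star [StarRing K] [StarRing A] [StarModule K A] {v : Aˣ} (hv : star v = v⁻¹)
    (f : K[T;T⁻¹]) : laurentEval v (star f) = star (laurentEval v f) := by
  induction f using LaurentPolynomial.induction_on' with
  | add f g hf hg => simp only [star_add, map_add, hf, hg]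
  | C_mul_T k a =>
    have hC : star (LaurentPolynomial.C a) = LaurentPolynomial.C (star a) := by
      rw [LaurentPolynomial.C_eq_algebraMap]
      exact star_algebraMap_laurent K a
    rw [star_mul', star_T, hC, laurentEval_C_mul_T, laurentEval_C_mul_T, star_smul,
      ← Units.coe_star, star_zpow, hv, inv_zpow']

theorem isUnit_laurentEval {v : Aˣ}
    (h : ∀ f : Polynomial K, f ≠ 0 → IsUnit (Polynomial.aeval (v : A) f))
    {f : K[T;T⁻¹]} (hf : f ≠ 0) : IsUnit (laurentEval v f) := by
  obtain ⟨k, g, hg⟩ := LaurentPolynomial.exists_T_pow f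
  have hg0 : g ≠ 0 := by
    rintro rfl
    rw [map_zero] at hg
    refine hf ((LaurentPolynomial.isUnit_T (k : ℤ)).mul_left_eq_zero.mp hg.symm)
  have h1 := h g hg0
  rw [← laurentEval_toLaurent, hg, map_mul, laurentEval_T, Units.isUnit_mul_units] at h1
  exact h1

variable [StarRing K]

/-- Evaluation of rational functions at a unit `v` at which all non-zero polynomials take
invertible values. -/
def rationalEval (v : Aˣ) (hv : ∀ f : Polynomial K, f ≠ 0 → IsUnit (Polynomial.aeval (v : A) f)) :
    RationalFunctions K →ₐ[K] A where
  __ := OreLocalization.universalHom (laurentEval v).toRingHom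
    (IsUnit.liftRight (((laurentEval v).toRingHom.toMonoidHom).comp
        (nonZeroDivisors K[T;T⁻¹]).subtype)
      fun f => isUnit_laurentEval hv (nonZeroDivisors.coe_ne_zero f))
    (fun _ => rfl)
  commutes' r := (OreLocalization.universalHom_commutes _ _ _).trans
    ((laurentEval v).commutes r)

variable {v : Aˣ} (hv : ∀ f : Polynomial K, f ≠ 0 → IsUnit (Polynomial.aeval (v : A) f))

theorem rationalEval_algebraMap (f : K[T;T⁻¹]) :
    rationalEval v hv (algebraMap _ _ f) = laurentEval v f :=
  OreLocalization.universalHom_commutes _ _ _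

/-- A rational function `x` satisfies `x b = a` with Laurent polynomials `a` and `b ≠ 0`. -/
theorem exists_mul_algebraMap_eq (x : RationalFunctions K) : ∃ a b : K[T;T⁻¹], b ≠ 0 ∧
    x * algebraMap _ (RationalFunctions K) b = algebraMap _ _ a := by
  obtain ⟨a, b, hb, rfl⟩ := IsFractionRing.div_surjective (A := K[T;T⁻¹]) x
  have hb0 : b ≠ 0 := nonZeroDivisors.ne_zero hb
  refine ⟨a, b, hb0, div_mul_cancel₀ _ ?_⟩
  simpa using hb0

theorem commute_rationalEval {x : A} (h : Commute (v : A) x) (f : RationalFunctions K) :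
    Commute (rationalEval v hv f) x := by
  obtain ⟨a, b, hb, hab⟩ := exists_mul_algebraMap_eq f
  have hu := isUnit_laurentEval hv hb
  have h1 := congrArg (rationalEval v hv) hab
  rw [map_mul, rationalEval_algebraMap, rationalEval_algebraMap] at h1
  refine hu.mul_right_cancel ?_
  rw [mul_assoc, ← (commute_laurentEval h b).eq, ← mul_assoc, h1, mul_assoc, h1,
    (commute_laurentEval h a).eq]

theorem rationalEval_star [StarRing A] [StarModule K A] (hs : star v = v⁻¹)
    (f : RationalFunctions K) : rationalEval v hv (star f) = star (rationalEval v hv f) := by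
  obtain ⟨a, b, hb, hab⟩ := exists_mul_algebraMap_eq f
  have hu := isUnit_laurentEval hv (star_ne_zero.mpr hb)
  have h1 := congrArg star (congrArg (rationalEval v hv) hab)
  have h2 := congrArg (rationalEval v hv) (congrArg star hab)
  rw [map_mul, rationalEval_algebraMap, rationalEval_algebraMap, star_mul,
    ← laurentEval_star hs, ← laurentEval_star hs] at h1
  rw [star_mul, star_algebraMap_rational, star_algebraMap_rational, map_mul,
    rationalEval_algebraMap, rationalEval_algebraMap] at h2
  exact hu.mul_left_cancel (h2.trans h1.symm)

end Evaluation

/-! ### Von Neumann regularity of matrix rings -/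
section MatrixRegular

/-- Every matrix over a field has a generalized inverse. -/
theorem exists_mul_mul_eq_self {F : Type*} [Field F] {r : ℕ} (x : Matrix (Fin r) (Fin r) F) :
    ∃ y, x * y * x = x := by
  obtain ⟨g, hg⟩ := (Matrix.toLin' x).rangeRestrict.exists_rightInverse_of_surjective
    (Matrix.toLin' x).range_rangeRestrict
  obtain ⟨l, hl⟩ := (LinearMap.range (Matrix.toLin' x)).subtype.exists_leftInverse_of_injective
    (LinearMap.range (Matrix.toLin' x)).ker_subtype
  refine ⟨LinearMap.toMatrix' (g ∘ₗ l), Matrix.toLin'.injective ?_⟩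
  rw [Matrix.toLin'_mul, Matrix.toLin'_mul, Matrix.toLin'_toMatrix']
  refine LinearMap.ext fun w => ?_
  have h1 := LinearMap.congr_fun hl ((Matrix.toLin' x).rangeRestrict w)
  have h2 := congrArg Subtype.val (LinearMap.congr_fun hg ((Matrix.toLin' x).rangeRestrict w))
  have h3 : l (Matrix.toLin' x w) = (Matrix.toLin' x).rangeRestrict w := h1
  rw [LinearMap.comp_apply, LinearMap.comp_apply, LinearMap.comp_apply, h3]
  exact h2

/-- For a positive definite involution, `x` and `x^* x` have the same kernel, hence the same
rank. -/
theorem rank_star_mul_self {K : Type*} [Field K] [StarRing K] (hK : IsPositiveDefinite K) {r : ℕ}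
    (x : Matrix (Fin r) (Fin r) K) : (star x * x).rank = x.rank := by
  have hker : LinearMap.ker (star x * x).mulVecLin = LinearMap.ker x.mulVecLin := by
    refine le_antisymm (fun w hw => ?_) fun w hw => ?_
    · rw [LinearMap.mem_ker, Matrix.mulVecLin_apply] at hw ⊢
      have h1 : star (x.mulVec w) ⬝ᵥ x.mulVec w = 0 := by
        rw [Matrix.star_mulVec, ← Matrix.dotProduct_mulVec, Matrix.mulVec_mulVec,
          ← Matrix.star_eq_conjTranspose, hw, dotProduct_zero]
      exact funext (hK r _ h1)
    · rw [LinearMap.mem_ker, Matrix.mulVecLin_apply] at hw ⊢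
      rw [← Matrix.mulVec_mulVec, hw, Matrix.mulVec_zero]
  have h1 := (star x * x).mulVecLin.finrank_range_add_finrank_ker
  have h2 := x.mulVecLin.finrank_range_add_finrank_ker
  rw [hker, ← h2] at h1
  exact Nat.add_right_cancel h1

end MatrixRegular

/-! ### The rank completion -/
section RankCompletion
variable {n : ℕ → ℕ} [∀ i, (n i).AtLeastTwo] {K : Type*} [Field K] [StarRing K]

variable (n K) in
/-- The canonical map `M_{p m}(K) → RankCompletion n K`. -/
def levelHom (m : ℕ) : Matrix (Fin (p n m)) (Fin (p n m)) K →⋆ₐ[K] RankCompletion n K where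
  __ := (UniformSpace.Completion.coeRingHom : MatrixLimit n K →+* RankCompletion n K).comp
    (MatrixLimit.of n K m : Matrix (Fin (p n m)) (Fin (p n m)) K →+* MatrixLimit n K)
  commutes' r := congrArg (fun x : MatrixLimit n K => (x : RankCompletion n K))
    (AlgHomClass.commutes (MatrixLimit.of n K m) r)
  map_star' f := (congrArg (fun x : MatrixLimit n K => (x : RankCompletion n K))
    (map_star (MatrixLimit.of n K m) f)).trans (RankCompletion.star_coe _).symm

theorem levelHom_apply (m : ℕ) (x : Matrix (Fin (p n m)) (Fin (p n m)) K) :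
    levelHom n K m x = (MatrixLimit.of n K m x : RankCompletion n K) := rfl

theorem levelHom_succ (m : ℕ) (x : Matrix (Fin (p n m)) (Fin (p n m)) K) :
    levelHom n K (m + 1) (constStep n K m x) = levelHom n K m x :=
  congrArg (fun x : MatrixLimit n K => (x : RankCompletion n K)) (MatrixLimit.of_succ m x)

theorem norm_levelHom (m : ℕ) (x : Matrix (Fin (p n m)) (Fin (p n m)) K) :
    ‖levelHom n K m x‖ = (x.rank : ℝ) / p n m := by
  rw [levelHom_apply, UniformSpace.Completion.norm_coe]
  rfl

instance : Nontrivial (RankCompletion n K) := by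
  refine ⟨1, 0, fun h => ?_⟩
  have h1 := norm_levelHom (n := n) (K := K) 0 1
  rw [map_one, h, norm_zero, Matrix.rank_one, Fintype.card_fin, div_self] at h1
  · exact zero_ne_one h1
  · exact Nat.cast_ne_zero.mpr (p_pos n 0).ne'

/-- The involution of the rank completion is proper, since `rk (x^* x) = rk x`. -/
theorem eq_zero_of_star_mul_self (hK : IsPositiveDefinite K) {x : RankCompletion n K}
    (hx : star x * x = 0) : x = 0 := by
  have h : ‖star x * x‖ = ‖x‖ := by
    -- the identity holds for every `x`, hence may be proved by density
    clear hx
    induction x using UniformSpace.Completion.induction_on with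
    | hp => exact isClosed_eq (by fun_prop) (by fun_prop)
    | ih x =>
      refine DirectLimit.induction _
        (C := fun x : MatrixLimit n K =>
          ‖star (x : RankCompletion n K) * x‖ = ‖(x : RankCompletion n K)‖) ?_ x
      intro m x
      change ‖star (levelHom n K m x) * levelHom n K m x‖ = ‖levelHom n K m x‖
      rw [← map_star, ← map_mul, norm_levelHom, norm_levelHom, rank_star_mul_self hK]
  rw [← norm_eq_zero, ← h, hx, norm_zero]

theorem MatrixLimit.norm_mul_mul_le (x y z : MatrixLimit n K) : ‖x * y * z‖ ≤ ‖y‖ :=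
  (MatrixLimit.rank_mul_le_left _ _).trans (MatrixLimit.rank_mul_le_right _ _)

/-- A limit in the rank completion of invertible elements is invertible: by
`x⁻¹ - y⁻¹ = x⁻¹ (y - x) y⁻¹`, inversion does not increase rank distances, so that the
inverses form a Cauchy sequence. -/
theorem isUnit_of_tendsto {x : RankCompletion n K} {y : ℕ → MatrixLimit n K}
    (hy : ∀ m, IsUnit (y m))
    (h : Filter.Tendsto (fun m => (y m : RankCompletion n K)) Filter.atTop (nhds x)) :
    IsUnit x := by
  choose z hz using hy
  have hdist (i j : ℕ) : dist ((↑(z i)⁻¹ : MatrixLimit n K) : RankCompletion n K)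
      ((↑(z j)⁻¹ : MatrixLimit n K) : RankCompletion n K) ≤
        dist (y i : RankCompletion n K) (y j : RankCompletion n K) := by
    rw [UniformSpace.Completion.dist_eq, UniformSpace.Completion.dist_eq, dist_comm (y i),
      dist_eq_norm, dist_eq_norm]
    refine le_trans (le_of_eq ?_) (MatrixLimit.norm_mul_mul_le (↑(z i)⁻¹) (y j - y i) (↑(z j)⁻¹))
    rw [← hz, ← hz, mul_sub, sub_mul, Units.inv_mul, one_mul, Units.mul_inv_cancel_right]
  have hc : CauchySeq fun m => ((↑(z m)⁻¹ : MatrixLimit n K) : RankCompletion n K) := by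
    rw [Metric.cauchySeq_iff]
    intro ε hε
    obtain ⟨N, hN⟩ := Metric.cauchySeq_iff.mp h.cauchySeq ε hε
    exact ⟨N, fun i hi j hj => (hdist i j).trans_lt (hN i hi j hj)⟩
  obtain ⟨w, hw⟩ := cauchySeq_tendsto_of_complete hc
  have h1 : x * w = 1 := tendsto_nhds_unique (h.mul hw) <| by
    refine tendsto_const_nhds.congr fun m => ?_
    rw [← UniformSpace.Completion.coe_mul, ← hz, Units.mul_inv, UniformSpace.Completion.coe_one]
  have h2 : w * x = 1 := tendsto_nhds_unique (hw.mul h) <| by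
    refine tendsto_const_nhds.congr fun m => ?_
    rw [← UniformSpace.Completion.coe_mul, ← hz, Units.inv_mul, UniformSpace.Completion.coe_one]
  exact ⟨⟨x, w, h1, h2⟩, rfl⟩

end RankCompletion

/-! ### Polynomials in the limit of the shift matrices are invertible -/
section ShiftPolynomial
variable {n : ℕ → ℕ} [∀ i, (n i).AtLeastTwo] {K : Type*} [Field K] [StarRing K]

variable (n K) in
/-- The shift matrix is strictly lower triangular. -/
theorem isNilpotent_shift (m : ℕ) : IsNilpotent (shift n K m) := by
  have h (k : ℕ) (a b : Fin (p n m)) (hab : (a : ℕ) < b + k) : (shift n K m ^ k) a b = 0 := by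
    induction k generalizing a b with
    | zero =>
      rw [pow_zero, Matrix.one_apply_ne]
      rintro rfl
      omega
    | succ k ih =>
      rw [pow_succ, Matrix.mul_apply]
      refine Finset.sum_eq_zero fun c _ => ?_
      rw [shift, Matrix.of_apply]
      split_ifs with hc
      · rw [← shift, ih a c (by omega), zero_mul]
      · rw [mul_zero]
  exact ⟨p n m, Matrix.ext fun a b => h _ a b (by omega)⟩

/-- A polynomial with non-zero constant term takes invertible values at nilpotent elements. -/
theorem isUnit_aeval_of_isNilpotent {A : Type*} [Ring A] [Algebra K A] {x : A} (hx : IsNilpotent x)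
    {f : Polynomial K} (hf : f.coeff 0 ≠ 0) : IsUnit (Polynomial.aeval x f) := by
  have hc : Commute x (Polynomial.aeval x f.divX) := by
    have := (Commute.all Polynomial.X f.divX).map (Polynomial.aeval x)
    rwa [Polynomial.aeval_X] at this
  rw [← Polynomial.X_mul_divX_add f, map_add, map_mul, Polynomial.aeval_X, Polynomial.aeval_C]
  exact (hc.isNilpotent_mul_right hx).isUnit_add_right_of_commute ((IsUnit.mk0 _ hf).map _)
    (Algebra.commutes _ _).symm

/-- Non-zero polynomials in `shiftLimit` are invertible: after division by a power of the unit
`shiftLimit`, the constant term is non-zero, and the polynomial is the limit of its invertible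
values at the nilpotent shift matrices. -/
theorem isUnit_aeval_shiftLimit {f : Polynomial K} (hf : f ≠ 0) :
    IsUnit (Polynomial.aeval (shiftLimit n K) f) := by
  obtain ⟨g, hg, hX⟩ := Polynomial.exists_eq_pow_rootMultiplicity_mul_and_not_dvd f hf 0
  rw [map_zero, sub_zero, Polynomial.X_dvd_iff] at hX
  rw [hg, map_zero, sub_zero, map_mul, map_pow, Polynomial.aeval_X]
  refine ((shiftUnit n K).isUnit.pow _).mul ?_
  refine isUnit_of_tendsto (y := fun m => MatrixLimit.of n K m (Polynomial.aeval (shift n K m) g))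
    (fun m => (isUnit_aeval_of_isNilpotent (isNilpotent_shift n K m) hX).map _) ?_
  refine (((Polynomial.continuous_aeval (A := RankCompletion n K) g).tendsto _).comp
    tendsto_shift).congr fun m => ?_
  exact Polynomial.aeval_algHom_apply
    (levelHom n K m : Matrix (Fin (p n m)) (Fin (p n m)) K →ₐ[K] RankCompletion n K) _ _

theorem isUnit_aeval_shiftUnit_pow {q : ℕ} (hq : 0 < q) {f : Polynomial K} (hf : f ≠ 0) :
    IsUnit (Polynomial.aeval
      ((shiftUnit n K ^ q : (RankCompletion n K)ˣ) : RankCompletion n K) f) := by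
  have h := isUnit_aeval_shiftLimit (n := n) ((Polynomial.expand_ne_zero hq).mpr hf)
  rwa [Polynomial.expand_aeval] at h

end ShiftPolynomial

/-! ### Matrix units and the limit of the shift matrices -/
section MatrixUnits
variable {n : ℕ → ℕ} [∀ i, (n i).AtLeastTwo] {K : Type*} [Field K] [StarRing K]

theorem shift_mul_star (m : ℕ) : shift n K m * star (shift n K m) =
    1 - Matrix.single ⟨0, p_pos n m⟩ ⟨0, p_pos n m⟩ 1 := by
  ext a b
  rw [Matrix.mul_apply]
  by_cases ha : (a : ℕ) = 0
  · rw [Finset.sum_eq_zero fun c _ => by simp [shift, ha]]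
    simp only [Matrix.sub_apply, Matrix.single_apply, Matrix.one_apply, Fin.ext_iff]
    split_ifs <;> first | omega | simp
  · rw [Finset.sum_eq_single ⟨a - 1, by omega⟩]
    · simp only [Matrix.sub_apply, Matrix.single_apply, Matrix.one_apply, Fin.ext_iff, shift,
        Matrix.star_apply, Matrix.of_apply]
      split_ifs <;> first | omega | simp
    · intro c _ hc
      have : ¬ (a : ℕ) = c + 1 := fun h => hc (Fin.ext (by simp only; omega))
      simp [shift, this]
    · simp

theorem star_mul_shift (m : ℕ) : star (shift n K m) * shift n K m =
    1 - Matrix.single ⟨p n m - 1, Nat.sub_lt (p_pos n m) one_pos⟩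
      ⟨p n m - 1, Nat.sub_lt (p_pos n m) one_pos⟩ 1 := by
  ext a b
  rw [Matrix.mul_apply]
  by_cases ha : (a : ℕ) + 1 < p n m
  · rw [Finset.sum_eq_single ⟨a + 1, ha⟩]
    · simp only [Matrix.sub_apply, Matrix.single_apply, Matrix.one_apply, Fin.ext_iff, shift,
        Matrix.star_apply, Matrix.of_apply]
      split_ifs <;> first | omega | simp
    · intro c _ hc
      have : ¬ (c : ℕ) = a + 1 := fun h => hc (Fin.ext h)
      simp [shift, Matrix.star_apply, this]
    · simp
  · rw [Finset.sum_eq_zero fun c _ => by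
      have : ¬ (c : ℕ) = a + 1 := by omega
      simp [shift, Matrix.star_apply, this]]
    simp only [Matrix.sub_apply, Matrix.single_apply, Matrix.one_apply, Fin.ext_iff]
    split_ifs <;> first | omega | simp

theorem shift_mul_star_mul (m : ℕ) :
    shift n K m * star (shift n K m) * shift n K m = shift n K m := by
  rw [shift_mul_star, sub_mul, one_mul, sub_eq_self]
  ext a b
  rw [Matrix.mul_apply]
  refine Finset.sum_eq_zero fun c _ => ?_
  simp only [Matrix.single_apply, Fin.ext_iff, shift, Matrix.of_apply]
  split_ifs <;> first | omega | simp

/-- The difference between `shift (m + 1)` and the image of `shift m` is supported in the rows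
`0, p m, 2 p m, …` and in the columns `p m - 1, 2 p m - 1, …`. -/
theorem constStep_shift_apply (m : ℕ) (a b : Fin (p n (m + 1)))
    (h : (a : ℕ) % p n m ≠ 0 ∨ (b : ℕ) % p n m ≠ p n m - 1) :
    constStep n K m (shift n K m) a b = shift n K (m + 1) a b := by
  rw [constStep_apply, shift, shift, Matrix.of_apply, Matrix.of_apply]
  simp only
  have hp := p_pos n m
  have h1 := Nat.div_add_mod (a : ℕ) (p n m)
  have h2 := Nat.div_add_mod (b : ℕ) (p n m)
  have h3 := Nat.mod_lt (a : ℕ) hp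
  have h4 := Nat.mod_lt (b : ℕ) hp
  by_cases hab : (a : ℕ) = b + 1
  · have h6 : ¬ p n m ∣ (b : ℕ) + 1 := by
      intro hd
      have h5 : (a : ℕ) % p n m = 0 := by
        rw [hab]; exact Nat.mod_eq_zero_of_dvd hd
      refine h.elim (fun h => h h5) fun h => h ?_
      rw [← h2, add_assoc, Nat.dvd_add_right (Nat.dvd_mul_right _ _)] at hd
      have := Nat.le_of_dvd (Nat.succ_pos _) hd
      omega
    have h7 : (a : ℕ) / p n m = b / p n m := by rw [hab, Nat.succ_div_of_not_dvd h6]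
    rw [h7] at h1
    rw [if_pos h7, if_pos (by omega), if_pos hab]
  · rw [if_neg hab]
    split_ifs with h7 h8
    · rw [h7, h8] at h1
      omega
    · rfl
    · rfl

theorem constStep_shift_mul_star_mul (m : ℕ) :
    constStep n K m (shift n K m * star (shift n K m)) * shift n K (m + 1) =
      constStep n K m (shift n K m) := by
  have h := congrArg (constStep n K m) (shift_mul_star_mul m)
  rw [map_mul] at h
  rw [← h]
  ext a b
  rw [Matrix.mul_apply, Matrix.mul_apply]
  refine Finset.sum_congr rfl fun c _ => ?_
  by_cases hc : (c : ℕ) % p n m = 0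
  · have h0 : constStep n K m (shift n K m * star (shift n K m)) a c = 0 := by
      rw [constStep_apply, shift_mul_star]
      simp only [Matrix.sub_apply, Matrix.single_apply, Matrix.one_apply, Fin.ext_iff, hc,
        and_true]
      split_ifs <;> first | omega | simp
    rw [h0, zero_mul, zero_mul]
  · rw [constStep_shift_apply m c b (Or.inl hc)]

theorem shift_mul_constStep_star_mul_shift (m : ℕ) :
    shift n K (m + 1) * constStep n K m (star (shift n K m) * shift n K m) =
      constStep n K m (shift n K m) := by
  have h := congrArg (constStep n K m) (shift_mul_star_mul m)
  rw [mul_assoc, map_mul] at h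
  rw [← h]
  ext a b
  rw [Matrix.mul_apply, Matrix.mul_apply]
  refine Finset.sum_congr rfl fun c _ => ?_
  by_cases hc : (c : ℕ) % p n m = p n m - 1
  · have h0 : constStep n K m (star (shift n K m) * shift n K m) c b = 0 := by
      rw [constStep_apply, star_mul_shift]
      simp only [Matrix.sub_apply, Matrix.single_apply, Matrix.one_apply, Fin.ext_iff, hc,
        true_and]
      split_ifs <;> first | omega | simp
    rw [h0, mul_zero, mul_zero]
  · rw [constStep_shift_apply m a c (Or.inr hc)]

/-- If each `s m` is a partial isometry and a restriction of `s (m + 1)`, on the side of the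
initial and of the final projection, then it is a restriction of all later ones. -/
theorem mul_star_mul_of_le {R : Type*} [Monoid R] [StarMul R] {s : ℕ → R}
    (h0 : ∀ m, s m * star (s m) * s m = s m)
    (h1 : ∀ m, s m * star (s m) * s (m + 1) = s m)
    (h2 : ∀ m, s (m + 1) * (star (s m) * s m) = s m) {i j : ℕ} (h : i ≤ j) :
    s i * star (s i) * s j = s i ∧ s j * (star (s i) * s i) = s i := by
  induction h with
  | refl => exact ⟨h0 i, by rw [← mul_assoc, h0]⟩
  | @step k h ih =>
    obtain ⟨ih1, ih2⟩ := ih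
    have h3 : s i * star (s i) * (s k * star (s k)) = s i * star (s i) := by
      rw [← mul_assoc, ih1]
      have := congrArg star ih2
      simp only [star_mul, star_star] at this
      nth_rw 1 [← h0 i]
      rw [mul_assoc, mul_assoc, ← mul_assoc (star (s i)), this]
    have h4 : star (s k) * s k * (star (s i) * s i) = star (s i) * s i := by
      rw [mul_assoc, ih2]
      have := congrArg star ih1
      simp only [star_mul, star_star] at this
      nth_rw 1 [← h0 i]
      rw [← mul_assoc, ← mul_assoc, mul_assoc (star (s k)), this]
    constructor
    · rw [← h3, mul_assoc, h1, ih1]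
    · rw [← h4, ← mul_assoc, h2, ih2]

theorem levelHom_shift_of_le {m M : ℕ} (h : m ≤ M) :
    levelHom n K m (shift n K m * star (shift n K m)) * levelHom n K M (shift n K M) =
        levelHom n K m (shift n K m) ∧
      levelHom n K M (shift n K M) * levelHom n K m (star (shift n K m) * shift n K m) =
        levelHom n K m (shift n K m) := by
  have key := mul_star_mul_of_le (s := fun m => levelHom n K m (shift n K m))
    (fun m => by rw [← map_star, ← map_mul, ← map_mul, shift_mul_star_mul])
    (fun m => by
      rw [← map_star, ← map_mul, ← levelHom_succ m (_ * _), ← map_mul, constStep_shift_mul_star_mul,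
        levelHom_succ])
    (fun m => by
      rw [← map_star, ← map_mul, ← levelHom_succ m (_ * _), ← map_mul,
        shift_mul_constStep_star_mul_shift,
        levelHom_succ]) h
  simp only [← map_star, ← map_mul] at key
  rwa [map_mul, map_mul (levelHom n K m) (star _)] at key ⊢

/-- Cutting down the range of the limit of the shift matrices to that of `S_m` gives `S_m`. -/
theorem levelHom_mul_shiftLimit (m : ℕ) :
    levelHom n K m (shift n K m * star (shift n K m)) * shiftLimit n K =
      levelHom n K m (shift n K m) := by
  refine tendsto_nhds_unique (tendsto_shift.const_mul _) (tendsto_const_nhds.congr' ?_)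
  filter_upwards [Filter.eventually_ge_atTop m] with M hM
  exact (levelHom_shift_of_le hM).1.symm

/-- The limit of the shift matrices agrees with `S_m` on the initial space of `S_m`. -/
theorem shiftLimit_mul_levelHom (m : ℕ) :
    shiftLimit n K * levelHom n K m (star (shift n K m) * shift n K m) =
      levelHom n K m (shift n K m) := by
  refine tendsto_nhds_unique (tendsto_shift.mul_const _) (tendsto_const_nhds.congr' ?_)
  filter_upwards [Filter.eventually_ge_atTop m] with M hM
  exact (levelHom_shift_of_le hM).2.symm

variable (n K) in
/-- The image in the rank completion of the matrix unit `e_{00}` of `M_{p m}(K)`. -/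
def corner (m : ℕ) : RankCompletion n K :=
  levelHom n K m (Matrix.single ⟨0, p_pos n m⟩ ⟨0, p_pos n m⟩ 1)

theorem corner_mul_shiftLimit (m : ℕ) :
    corner n K m * shiftLimit n K = shiftLimit n K - levelHom n K m (shift n K m) := by
  have h := levelHom_mul_shiftLimit (n := n) (K := K) m
  rw [shift_mul_star, map_sub, map_one, sub_mul, one_mul] at h
  rw [← h, sub_sub_cancel]
  rfl

theorem shiftLimit_mul_last (m : ℕ) :
    shiftLimit n K * levelHom n K m (Matrix.single ⟨p n m - 1, Nat.sub_lt (p_pos n m) one_pos⟩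
      ⟨p n m - 1, Nat.sub_lt (p_pos n m) one_pos⟩ 1) =
        shiftLimit n K - levelHom n K m (shift n K m) := by
  have h := shiftLimit_mul_levelHom (n := n) (K := K) m
  rw [star_mul_shift, map_sub, map_one, mul_sub, mul_one] at h
  rw [← h, sub_sub_cancel]

theorem shiftLimit_mul_single {m i : ℕ} (hi : i + 1 < p n m) (j : Fin (p n m)) :
    shiftLimit n K * levelHom n K m (Matrix.single ⟨i, by omega⟩ j 1) =
      levelHom n K m (Matrix.single ⟨i + 1, hi⟩ j 1) := by
  have h1 : star (shift n K m) * shift n K m * Matrix.single ⟨i, by omega⟩ j 1 =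
      Matrix.single ⟨i, by omega⟩ j 1 := by
    rw [star_mul_shift, sub_mul, one_mul, Matrix.single_mul_single_of_ne, sub_zero]
    simp only [ne_eq, Fin.ext_iff]
    omega
  have h2 : shift n K m * Matrix.single ⟨i, by omega⟩ j 1 = Matrix.single ⟨i + 1, hi⟩ j 1 := by
    ext a b
    rw [Matrix.mul_apply, Finset.sum_eq_single ⟨i, by omega⟩]
    · simp only [Matrix.single_apply, shift, Matrix.of_apply, Fin.ext_iff, true_and]
      split_ifs <;> first | omega | simp
    · intro c _ hc
      rw [Matrix.single_apply_of_row_ne hc.symm, mul_zero]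
    · simp
  rw [← h1, map_mul, ← mul_assoc, shiftLimit_mul_levelHom, ← map_mul, h2]

theorem star_corner (m : ℕ) : star (corner n K m) = corner n K m := by
  rw [corner, ← map_star, Matrix.star_eq_conjTranspose, Matrix.conjTranspose_single, star_one]

/-- Matrix units in terms of the limit `u` of the shift matrices: `e_{ij} = uⁱ e_{00} (u^*)ʲ`. -/
theorem levelHom_single {m : ℕ} (i j : Fin (p n m)) :
    levelHom n K m (Matrix.single i j 1) =
      shiftLimit n K ^ (i : ℕ) * corner n K m * star (shiftLimit n K) ^ (j : ℕ) := by
  have h (k : ℕ) (hk : k < p n m) : levelHom n K m (Matrix.single ⟨k, hk⟩ ⟨0, p_pos n m⟩ 1) =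
      shiftLimit n K ^ k * corner n K m := by
    induction k with
    | zero => rw [pow_zero, one_mul, corner]
    | succ k ih =>
      rw [← shiftLimit_mul_single hk, ih, pow_succ', mul_assoc]
  have h1 := congrArg star (h j j.2)
  rw [← map_star, Matrix.star_eq_conjTranspose, Matrix.conjTranspose_single, star_one, star_mul,
    star_pow, star_corner] at h1
  have h2 : (Matrix.single i j 1 : Matrix (Fin (p n m)) (Fin (p n m)) K) =
      Matrix.single i ⟨0, p_pos n m⟩ 1 * (Matrix.single ⟨0, p_pos n m⟩ ⟨0, p_pos n m⟩ 1 *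
        Matrix.single ⟨0, p_pos n m⟩ j 1) := by
    simp
  have h3 : corner n K m * corner n K m = corner n K m := by
    rw [corner, ← map_mul, Matrix.single_mul_single_same, one_mul]
  rw [h2, map_mul, map_mul, h1, h i i.2, ← corner, ← mul_assoc (corner n K m), h3, mul_assoc,
    ← mul_assoc (corner n K m), h3, mul_assoc]

theorem star_pow_mul_shiftLimit_pow (k : ℕ) :
    star (shiftLimit n K) ^ k * shiftLimit n K ^ k = 1 := by
  have h : Commute (star (shiftLimit n K)) (shiftLimit n K) :=
    star_mul_shiftLimit.trans shiftLimit_mul_star.symm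
  rw [← h.mul_pow, star_mul_shiftLimit, one_pow]

theorem shiftLimit_pow_mul_first_last (m : ℕ) :
    shiftLimit n K ^ p n m * levelHom n K m (Matrix.single ⟨0, p_pos n m⟩
      ⟨p n m - 1, Nat.sub_lt (p_pos n m) one_pos⟩ 1) =
        shiftLimit n K - levelHom n K m (shift n K m) := by
  have hp := p_pos n m
  obtain ⟨r, hr⟩ : ∃ r, p n m = r + 1 := ⟨p n m - 1, by omega⟩
  rw [← shiftLimit_mul_last, levelHom_single, levelHom_single]
  simp only [hr, Nat.add_sub_cancel, pow_succ', pow_zero, one_mul, mul_assoc]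

/-- Cancel `(u^*) ^ (p m - 1)` in `u ^ p m e_{00} (u^*) ^ (p m - 1) = u - S_m = e_{00} u`. -/
theorem commute_shiftLimit_pow_corner (m : ℕ) :
    Commute (shiftLimit n K ^ p n m) (corner n K m) := by
  have h := (shiftLimit_pow_mul_first_last (n := n) (K := K) m).trans
    (corner_mul_shiftLimit m).symm
  rw [levelHom_single] at h
  simp only [pow_zero, one_mul] at h
  have hp := p_pos n m
  obtain ⟨r, hr⟩ : ∃ r, p n m = r + 1 := ⟨p n m - 1, by omega⟩
  rw [hr, Nat.add_sub_cancel] at h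
  have h1 := congrArg (· * shiftLimit n K ^ r) h
  simp only [mul_assoc] at h1
  rw [star_pow_mul_shiftLimit_pow, mul_one, ← pow_succ'] at h1
  rw [hr]
  exact h1

theorem commute_shiftUnit_pow_levelHom (m : ℕ) (x : Matrix (Fin (p n m)) (Fin (p n m)) K) :
    Commute ((shiftUnit n K ^ p n m : (RankCompletion n K)ˣ) : RankCompletion n K)
      (levelHom n K m x) := by
  have hu : Commute ((shiftUnit n K ^ p n m : (RankCompletion n K)ˣ) : RankCompletion n K)
      (shiftLimit n K) := by
    rw [Units.val_pow_eq_pow_val]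
    exact Commute.pow_self (shiftLimit n K) _
  have hs : Commute ((shiftUnit n K ^ p n m : (RankCompletion n K)ˣ) : RankCompletion n K)
      (star (shiftLimit n K)) := by
    rw [Units.val_pow_eq_pow_val]
    exact (show Commute (shiftLimit n K) (star (shiftLimit n K)) from
      shiftLimit_mul_star.trans star_mul_shiftLimit.symm).pow_left _
  have hc : Commute ((shiftUnit n K ^ p n m : (RankCompletion n K)ˣ) : RankCompletion n K)
      (corner n K m) := by
    rw [Units.val_pow_eq_pow_val]
    exact commute_shiftLimit_pow_corner m
  rw [Matrix.matrix_eq_sum_single x, map_sum]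
  refine Commute.sum_right _ _ _ fun i _ => ?_
  rw [map_sum]
  refine Commute.sum_right _ _ _ fun j _ => ?_
  rw [← mul_one (x i j), ← smul_eq_mul, ← Matrix.smul_single, map_smul, levelHom_single]
  exact (((hu.pow_right _).mul_right hc).mul_right (hs.pow_right _)).smul_right _

end MatrixUnits

/-! ### The embedding of the rational matrix algebras into the rank completion -/
section Embedding
variable {n : ℕ → ℕ} [∀ i, (n i).AtLeastTwo] {K : Type*} [Field K] [StarRing K]

variable (n K) in
/-- The embedding `K(s) → RankCompletion n K` that sends `s` to the power `u ^ p m` of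
`u = shiftUnit`. -/
def scalarHom (m : ℕ) : RationalFunctions K →ₐ[K] RankCompletion n K :=
  rationalEval (shiftUnit n K ^ p n m) fun _ hf => isUnit_aeval_shiftUnit_pow (p_pos n m) hf

theorem scalarHom_star (m : ℕ) (f : RationalFunctions K) :
    scalarHom n K m (star f) = star (scalarHom n K m f) :=
  rationalEval_star _ (by
    have hU : star (shiftUnit n K) = (shiftUnit n K)⁻¹ := Units.ext rfl
    rw [star_pow, hU, inv_pow]) f

theorem scalarHom_T (m : ℕ) : scalarHom n K m (algebraMap K[T;T⁻¹] _ (LaurentPolynomial.T 1)) =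
    shiftLimit n K ^ p n m := by
  rw [scalarHom, rationalEval_algebraMap, laurentEval_T, zpow_one, Units.val_pow_eq_pow_val]
  rfl

theorem commute_scalarHom_levelHom (m : ℕ) (f : RationalFunctions K)
    (x : Matrix (Fin (p n m)) (Fin (p n m)) K) :
    Commute (scalarHom n K m f) (levelHom n K m x) :=
  commute_rationalEval _ (commute_shiftUnit_pow_levelHom m x) f

variable (n K) in
/-- The homomorphism `M_{p m}(K(s)) → RankCompletion n K` that extends `levelHom` and
`scalarHom`. -/
def rationalLevelAlgHom (m : ℕ) :
    Matrix (Fin (p n m)) (Fin (p n m)) (RationalFunctions K) →ₐ[K] RankCompletion n K :=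
  (Algebra.TensorProduct.lift (scalarHom n K m)
    (levelHom n K m : Matrix (Fin (p n m)) (Fin (p n m)) K →ₐ[K] RankCompletion n K)
    (commute_scalarHom_levelHom m)).comp
    (matrixEquivTensor (Fin (p n m)) K (RationalFunctions K)).toAlgHom

theorem rationalLevelAlgHom_single (m : ℕ) (i j : Fin (p n m)) (f : RationalFunctions K) :
    rationalLevelAlgHom n K m (Matrix.single i j f) =
      scalarHom n K m f * levelHom n K m (Matrix.single i j 1) := by
  rw [rationalLevelAlgHom, AlgHom.comp_apply]
  change Algebra.TensorProduct.lift _ _ _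
    (matrixEquivTensor (Fin (p n m)) K (RationalFunctions K) _) = _
  rw [matrixEquivTensor_apply_single, Algebra.TensorProduct.lift_tmul]
  rfl

variable (n K) in
/-- `rationalLevelAlgHom` as a `*`-homomorphism. -/
def rationalLevelHom (m : ℕ) :
    Matrix (Fin (p n m)) (Fin (p n m)) (RationalFunctions K) →⋆ₐ[K] RankCompletion n K where
  __ := rationalLevelAlgHom n K m
  map_star' x := by
    change rationalLevelAlgHom n K m (star x) = star (rationalLevelAlgHom n K m x)
    rw [Matrix.matrix_eq_sum_single x]
    simp only [star_sum, map_sum]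
    refine Finset.sum_congr rfl fun i _ => Finset.sum_congr rfl fun j _ => ?_
    rw [Matrix.star_eq_conjTranspose, Matrix.conjTranspose_single, rationalLevelAlgHom_single,
      rationalLevelAlgHom_single, star_mul, ← map_star, Matrix.star_eq_conjTranspose,
      Matrix.conjTranspose_single, star_one, ← scalarHom_star]
    exact commute_scalarHom_levelHom _ _ _

theorem rationalLevelHom_single (m : ℕ) (i j : Fin (p n m)) (f : RationalFunctions K) :
    rationalLevelHom n K m (Matrix.single i j f) =
      scalarHom n K m f * levelHom n K m (Matrix.single i j 1) :=
  rationalLevelAlgHom_single m i j f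

theorem rationalLevelHom_map (m : ℕ) (x : Matrix (Fin (p n m)) (Fin (p n m)) K) :
    rationalLevelHom n K m (x.map (algebraMap K (RationalFunctions K))) = levelHom n K m x := by
  conv_rhs => rw [Matrix.matrix_eq_sum_single x]
  rw [Matrix.matrix_eq_sum_single (x.map _)]
  simp only [map_sum]
  refine Finset.sum_congr rfl fun i _ => Finset.sum_congr rfl fun j _ => ?_
  rw [rationalLevelHom_single, Matrix.map_apply, AlgHom.commutes, ← Algebra.smul_def, ← map_smul,
    Matrix.smul_single, smul_eq_mul, mul_one]

variable (n K) in
/-- The companion matrix of size `p m` over `K(s)`: it represents the generator `t` of `ℤ`. -/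
def rationalCompanion (m : ℕ) : Matrix (Fin (p n m)) (Fin (p n m)) (RationalFunctions K) :=
  (companion K (p n m)).map (algebraMap K[T;T⁻¹] (RationalFunctions K))

theorem rationalLevelHom_companion (m : ℕ) :
    rationalLevelHom n K m (rationalCompanion n K m) = shiftLimit n K := by
  have hp := p_pos n m
  have h : rationalCompanion n K m = (shift n K m).map (algebraMap K (RationalFunctions K)) +
      Matrix.single ⟨0, p_pos n m⟩ ⟨p n m - 1, Nat.sub_lt (p_pos n m) one_pos⟩
        (algebraMap _ _ (LaurentPolynomial.T 1 : K[T;T⁻¹])) := by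
    ext a b
    rw [Matrix.add_apply, rationalCompanion, Matrix.map_apply, Matrix.map_apply]
    simp only [companion, shift, Matrix.of_apply, Matrix.single_apply, Fin.ext_iff]
    split_ifs <;> first | omega | simp
  rw [h, map_add, rationalLevelHom_map, rationalLevelHom_single, scalarHom_T,
    shiftLimit_pow_mul_first_last, add_sub_cancel]

theorem rationalCompanion_pow (m : ℕ) : rationalCompanion n K m ^ p n m =
    algebraMap _ _ (algebraMap K[T;T⁻¹] (RationalFunctions K) (LaurentPolynomial.T 1)) := by
  rw [rationalCompanion, ← RingHom.mapMatrix_apply, ← map_pow, companion_pow _ _ _ le_rfl]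
  ext a b
  rw [RingHom.mapMatrix_apply, Matrix.map_apply, Matrix.algebraMap_matrix_apply]
  simp only [Matrix.of_apply, Fin.ext_iff]
  split_ifs <;> first | omega | simp

theorem eq_succ_iff_div_mod {q : ℕ} (hq : 0 < q) (a b : ℕ) : a = b + 1 ↔
    (a % q = b % q + 1 ∧ a / q = b / q) ∨ (a % q = 0 ∧ b % q + 1 = q ∧ a / q = b / q + 1) := by
  have h1 := Nat.div_add_mod a q
  have h2 := Nat.div_add_mod b q
  constructor
  · rintro rfl
    by_cases h : q ∣ b + 1
    · refine Or.inr ⟨Nat.mod_eq_zero_of_dvd h, ?_, Nat.succ_div_of_dvd h⟩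
      rw [← h2, add_assoc, Nat.dvd_add_right (Nat.dvd_mul_right _ _)] at h
      have h3 := Nat.le_of_dvd (Nat.succ_pos _) h
      have h4 := Nat.mod_lt b hq
      omega
    · have h3 := Nat.succ_div_of_not_dvd h
      rw [h3] at h1
      exact Or.inl ⟨by omega, h3⟩
  · rintro (⟨h3, h4⟩ | ⟨h3, h4, h5⟩)
    · rw [h4] at h1
      omega
    · rw [h5, mul_add] at h1
      omega

theorem laurentStep_companion (m : ℕ) :
    laurentStep n K m (companion K (p n m)) = companion K (p n (m + 1)) := by
  ext1 a b
  have hp := p_pos n m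
  have hE : laurentStep n K m (companion K (p n m)) a b = laurentHom K (n m)
      (companion K (p n m) ⟨a % p n m, Nat.mod_lt _ hp⟩ ⟨b % p n m, Nat.mod_lt _ hp⟩)
      (Fin.divNat (n := p n m) (m := n m) a) (Fin.divNat (n := p n m) (m := n m) b) := rfl
  have hA : ((Fin.divNat (n := p n m) (m := n m) a : Fin (n m)) : ℕ) = a / p n m := rfl
  have hB : ((Fin.divNat (n := p n m) (m := n m) b : Fin (n m)) : ℕ) = b / p n m := rfl
  have h1 := Nat.div_add_mod (a : ℕ) (p n m)
  have h2 := Nat.div_add_mod (b : ℕ) (p n m)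
  have h3 := Nat.mod_lt (a : ℕ) hp
  have h4 := Nat.mod_lt (b : ℕ) hp
  have hpS : p n (m + 1) = n m * p n m := rfl
  rw [hE]
  simp only [companion, Matrix.of_apply]
  have h5 := eq_succ_iff_div_mod hp (a : ℕ) b
  have h6 : (a : ℕ) = 0 ↔ (a : ℕ) % p n m = 0 ∧ (a : ℕ) / p n m = 0 := by
    constructor
    · intro h; simp [h]
    · rintro ⟨h, h'⟩; rw [← h1, h, h', mul_zero]
  have h7 := eq_succ_iff_div_mod hp (n m * p n m) b
  rw [Nat.mul_mod_left, Nat.mul_div_cancel _ hp, ← hpS] at h7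
  by_cases c1 : (a : ℕ) % p n m = b % p n m + 1
  · rw [if_pos c1, map_one, Matrix.one_apply]
    simp only [Fin.ext_iff, hA, hB]
    split_ifs <;> first | rfl | omega
  · rw [if_neg c1]
    by_cases c2 : (a : ℕ) % p n m = 0 ∧ (b : ℕ) % p n m + 1 = p n m
    · rw [if_pos c2, laurentHom_T, zpow_one]
      change companion K (n m) _ _ = _
      simp only [companion, Matrix.of_apply, hA, hB]
      split_ifs <;> first | rfl | omega
    · rw [if_neg c2, map_zero, Matrix.zero_apply]
      split_ifs <;> first | rfl | omega

theorem rationalStep_companion (m : ℕ) :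
    rationalStep n K m (rationalCompanion n K m) = rationalCompanion n K (m + 1) := by
  rw [rationalCompanion, rationalStep_map, laurentStep_companion]
  rfl

theorem rationalStep_map_const (m : ℕ) (x : Matrix (Fin (p n m)) (Fin (p n m)) K) :
    rationalStep n K m (x.map (algebraMap K (RationalFunctions K))) =
      (constStep n K m x).map (algebraMap K (RationalFunctions K)) := by
  ext a b
  have h1 : rationalStep n K m (x.map (algebraMap K (RationalFunctions K))) a b =
      rationalHom K (n m) (algebraMap K (RationalFunctions K)
        (x (Fin.modNat (n := p n m) (m := n m) a) (Fin.modNat (n := p n m) (m := n m) b)))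
      (Fin.divNat (n := p n m) (m := n m) a) (Fin.divNat (n := p n m) (m := n m) b) := rfl
  have h2 : constStep n K m x a b = algebraMap K (Matrix (Fin (n m)) (Fin (n m)) K)
      (x (Fin.modNat (n := p n m) (m := n m) a) (Fin.modNat (n := p n m) (m := n m) b))
      (Fin.divNat (n := p n m) (m := n m) a) (Fin.divNat (n := p n m) (m := n m) b) := rfl
  rw [h1, Matrix.map_apply, h2, AlgHomClass.commutes, Matrix.algebraMap_matrix_apply,
    Matrix.algebraMap_matrix_apply]
  split_ifs <;> simp

/-- Homomorphisms on `K(s)` are determined by the image of `s`. -/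
theorem rationalFunctions_algHom_ext {A : Type*} [Ring A] [Algebra K A]
    {f g : RationalFunctions K →ₐ[K] A}
    (h : f (algebraMap K[T;T⁻¹] _ (LaurentPolynomial.T 1)) =
      g (algebraMap K[T;T⁻¹] _ (LaurentPolynomial.T 1))) : f = g := by
  have h1 : f.comp (IsScalarTower.toAlgHom K K[T;T⁻¹] (RationalFunctions K)) =
      g.comp (IsScalarTower.toAlgHom K K[T;T⁻¹] (RationalFunctions K)) := by
    apply AddMonoidAlgebra.algHom_ext'
    case single_one_left => exact Subsingleton.elim _ _
    exact MonoidHom.ext_mint h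
  have h2 : (f : RationalFunctions K →+* A) = g :=
    IsLocalization.ringHom_ext (nonZeroDivisors K[T;T⁻¹]) 
      (RingHom.ext fun x => DFunLike.congr_fun h1 x)
  exact AlgHom.ext fun x => DFunLike.congr_fun h2 x

/-- Both sides agree on constant matrices; on scalars it suffices to compare the images of `s`,
a power of the companion matrix. -/
theorem rationalLevelHom_step (m : ℕ)
    (x : Matrix (Fin (p n m)) (Fin (p n m)) (RationalFunctions K)) :
    rationalLevelHom n K (m + 1) (rationalStep n K m x) = rationalLevelHom n K m x := by
  have hs (f : RationalFunctions K) :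
      rationalLevelHom n K (m + 1) (rationalStep n K m (algebraMap _ _ f)) =
        scalarHom n K m f := by
    have h : (((rationalLevelHom n K (m + 1)).comp (rationalStep n K m) :
        Matrix (Fin (p n m)) (Fin (p n m)) (RationalFunctions K) →⋆ₐ[K] RankCompletion n K) :
        Matrix (Fin (p n m)) (Fin (p n m)) (RationalFunctions K) →ₐ[K] RankCompletion n K).comp
        (IsScalarTower.toAlgHom K (RationalFunctions K) _) = scalarHom n K m := by
      refine rationalFunctions_algHom_ext ?_
      change rationalLevelHom n K (m + 1) (rationalStep n K m (algebraMap _ _ _)) = _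
      rw [← rationalCompanion_pow, map_pow, map_pow, rationalStep_companion,
        rationalLevelHom_companion, scalarHom_T]
    exact DFunLike.congr_fun h f
  rw [Matrix.matrix_eq_sum_single x]
  simp only [map_sum]
  refine Finset.sum_congr rfl fun i _ => Finset.sum_congr rfl fun j _ => ?_
  have h1 : Matrix.single i j (x i j) = algebraMap (RationalFunctions K) _ (x i j) *
      (Matrix.single i j (1 : K)).map (algebraMap K (RationalFunctions K)) := by
    rw [← Algebra.smul_def, Matrix.map_single, map_one, Matrix.smul_single, smul_eq_mul, mul_one]
  rw [rationalLevelHom_single, h1, map_mul, map_mul, hs, rationalStep_map_const,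
    rationalLevelHom_map, levelHom_succ]

end Embedding

/-! ### The embedding of the direct limit and its range -/
section Range
variable {n : ℕ → ℕ} [∀ i, (n i).AtLeastTwo] {K : Type*} [Field K] [StarRing K]

theorem rationalLevelHom_transition {i j : ℕ} (h : i ≤ j)
    (x : Matrix (Fin (p n i)) (Fin (p n i)) (RationalFunctions K)) :
    rationalLevelHom n K j (transition (rationalStep n K) i j h x) = rationalLevelHom n K i x := by
  induction h with
  | refl => rw [transition_self]; rfl
  | @step k h ih =>
    rw [transition_succ _ h, ← ih]
    exact rationalLevelHom_step k _

variable (n K) in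
/-- The homomorphism from the direct limit of the `M_{p m}(K(t ^ p m))` to the rank completion. -/
def limitHom : RationalLimit n K →⋆ₐ[K] RankCompletion n K where
  __ := DirectLimit.Ring.lift _ (transition (rationalStep n K)) (RankCompletion n K)
    (fun m => (rationalLevelHom n K m : _ →+* RankCompletion n K))
    (fun _ _ h x => rationalLevelHom_transition h x)
  commutes' r := by
    rw [← AlgHomClass.commutes (SeqLimit.of (rationalStep n K) 0) r]
    exact AlgHomClass.commutes (rationalLevelHom n K 0) r
  map_star' x := by
    induction x using DirectLimit.induction with
    | _ m x => exact map_star (rationalLevelHom n K m) x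

theorem limitHom_of (m : ℕ) (x : Matrix (Fin (p n m)) (Fin (p n m)) (RationalFunctions K)) :
    limitHom n K (SeqLimit.of (rationalStep n K) m x) = rationalLevelHom n K m x := rfl

theorem exists_of_eq (x : RationalLimit n K) :
    ∃ m y, SeqLimit.of (rationalStep n K) m y = x := by
  induction x using DirectLimit.induction with
  | _ m x => exact ⟨m, x, rfl⟩

/-- The embedding is injective because matrix rings over a field are simple. -/
theorem limitHom_injective : Function.Injective (limitHom n K) := by
  refine (injective_iff_map_eq_zero _).mpr fun x hx => ?_
  obtain ⟨m, y, rfl⟩ := exists_of_eq x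
  have : Nonempty (Fin (p n m)) := ⟨⟨0, p_pos n m⟩⟩
  have hinj : Function.Injective (rationalLevelHom n K m) :=
    RingHom.injective (rationalLevelHom n K m : Matrix (Fin (p n m)) (Fin (p n m))
      (RationalFunctions K) →+* RankCompletion n K)
  rw [limitHom_of] at hx
  rw [hinj (hx.trans (map_zero _).symm), map_zero]

theorem isStarRegular_range (hK : IsPositiveDefinite K) :
    IsStarRegular (limitHom n K).range := by
  constructor
  · rintro ⟨_, x, rfl⟩
    obtain ⟨m, x, rfl⟩ := exists_of_eq x
    obtain ⟨y, hy⟩ := exists_mul_mul_eq_self x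
    refine ⟨⟨_, SeqLimit.of (rationalStep n K) m y, rfl⟩, Subtype.ext ?_⟩
    change limitHom n K _ * limitHom n K _ * limitHom n K _ = limitHom n K _
    rw [← map_mul, ← map_mul, ← map_mul, ← map_mul, hy]
  · intro x hx
    exact Subtype.ext (eq_zero_of_star_mul_self hK (congrArg Subtype.val hx))

theorem shiftUnit_zpow_mem {B : StarSubalgebra K (RankCompletion n K)}
    (h : shiftLimit n K ∈ B) (k : ℤ) :
    ((shiftUnit n K ^ k : (RankCompletion n K)ˣ) : RankCompletion n K) ∈ B := by
  cases k with
  | ofNat k =>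
    rw [Int.ofNat_eq_natCast, zpow_natCast, Units.val_pow_eq_pow_val]
    exact pow_mem h k
  | negSucc k =>
    rw [zpow_negSucc, ← inv_pow, Units.val_pow_eq_pow_val]
    exact pow_mem (star_mem h) _

theorem range_representation_subset :
    Set.range (representation n K) ⊆ (limitHom n K).range := by
  have hlevel (m : ℕ) (x : Matrix (Fin (p n m)) (Fin (p n m)) (RationalFunctions K)) :
      rationalLevelHom n K m x ∈ (limitHom n K).range := ⟨_, limitHom_of m x⟩
  rintro _ ⟨a, rfl⟩
  induction a using SkewMonoidAlgebra.induction_on' with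
  | add a b ha hb => rw [map_add]; exact add_mem ha hb
  | single k f =>
    have h := representationAlgHom_single k f
    change representation n K _ = _ at h
    rw [h]
    obtain ⟨m, hf⟩ := exists_isLevel f
    refine mul_mem ?_ (shiftUnit_zpow_mem ?_ _)
    · have h1 : functionsHom n K f = levelHom n K m (diagonal m f) :=
        congrArg (fun x : MatrixLimit n K => (x : RankCompletion n K)) (diagonalFun_eq hf)
      rw [h1, ← rationalLevelHom_map]
      exact hlevel _ _
    · rw [← rationalLevelHom_companion 0]
      exact hlevel _ _

/-- The first `m` digits of `T ^ a 0` vanish if and only if `p m` divides `a`. -/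
theorem orbit_digits_eq_zero_iff (m a : ℕ) :
    (∀ i < m, (((odometer ^ a : Space n ≃ₜ Space n) 0 i : Fin (n i)) : ℕ) = 0) ↔ p n m ∣ a := by
  cases a with
  | zero => simp
  | succ a =>
    rw [p_dvd_succ_iff, pow_succ']
    change (∀ i < m, (addOne ((odometer ^ a : Space n ≃ₜ Space n) 0) i : ℕ) = 0) ↔ _
    rw [addOne_lt_zero_iff]
    simp only [orbit_digit]

theorem isClopen_cylinder (x : Space n) (m : ℕ) : IsClopen (PiNat.cylinder x m) := by
  refine ⟨?_, PiNat.isOpen_cylinder _ _ _⟩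
  rw [PiNat.cylinder_eq_pi]
  exact isClosed_set_pi fun i _ => isClosed_singleton

variable (n K) in
/-- The characteristic function of the cylinder set `[0 … 0]` of length `m`. -/
def cylinderFun (m : ℕ) : Functions n K :=
  LocallyConstant.charFn K (U := PiNat.cylinder (0 : Space n) m)
    (isClopen_cylinder 0 m)

open Classical in
theorem cylinderFun_apply (m : ℕ) (x : Space n) :
    cylinderFun n K m x = if ∀ i < m, (x i : ℕ) = 0 then 1 else 0 := by
  rw [cylinderFun, LocallyConstant.coe_charFn, Set.indicator_apply]
  exact if_congr (forall₂_congr fun i _ => Fin.ext_iff) rfl rfl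

theorem cylinderFun_isLevel (m : ℕ) : IsLevel m (cylinderFun n K m) := by
  intro x y hxy
  rw [cylinderFun_apply, cylinderFun_apply]
  exact if_congr (forall₂_congr fun i hi => by rw [hxy i hi]) rfl rfl

theorem diagonal_cylinderFun (m : ℕ) : diagonal m (cylinderFun n K m) =
    Matrix.single ⟨0, p_pos n m⟩ ⟨0, p_pos n m⟩ 1 := by
  have h (a : Fin (p n m)) : cylinderFun n K m ((odometer ^ (a : ℕ) : Space n ≃ₜ Space n) 0) =
      if (a : ℕ) = 0 then 1 else 0 := by
    rw [cylinderFun_apply]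
    refine if_congr ((orbit_digits_eq_zero_iff m a).trans ?_) rfl rfl
    exact ⟨fun h => Nat.eq_zero_of_dvd_of_lt h a.2, fun h => h ▸ dvd_zero _⟩
  ext a b
  rw [diagonal, Matrix.diagonal_apply, h, Matrix.single_apply]
  simp only [Fin.ext_iff]
  split_ifs <;> first | rfl | omega

theorem corner_mem_range_representation (m : ℕ) :
    corner n K m ∈ Set.range (representation n K) :=
  ⟨_, (representation_functions (cylinderFun_isLevel m)).trans (by
    rw [diagonal_cylinderFun]; rfl)⟩

/-- A regular subalgebra that contains the generator `u` contains the field generated by each of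
its powers: a generalized inverse of an invertible element is its inverse. -/
theorem scalarHom_mem {B : StarSubalgebra K (RankCompletion n K)} (hB : IsStarRegular B)
    (h : shiftLimit n K ∈ B) (m : ℕ) (f : RationalFunctions K) : scalarHom n K m f ∈ B := by
  have hL (g : K[T;T⁻¹]) : scalarHom n K m (algebraMap _ _ g) ∈ B := by
    rw [scalarHom, rationalEval_algebraMap]
    induction g using LaurentPolynomial.induction_on' with
    | add f g hf hg => rw [map_add]; exact add_mem hf hg
    | C_mul_T k a =>
      rw [laurentEval_C_mul_T, ← zpow_natCast, ← zpow_mul]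
      exact B.smul_mem (shiftUnit_zpow_mem h _) a
  obtain ⟨a, b, hb, hab⟩ := exists_mul_algebraMap_eq f
  have hb0 : algebraMap K[T;T⁻¹] (RationalFunctions K) b ≠ 0 := by simpa using hb
  obtain ⟨⟨y, hyB⟩, hy⟩ := hB.1 ⟨_, hL b⟩
  have hy' : scalarHom n K m (algebraMap _ _ b) * y * scalarHom n K m (algebraMap _ _ b) =
    scalarHom n K m (algebraMap _ _ b) := congrArg Subtype.val hy
  have hu : IsUnit (scalarHom n K m (algebraMap K[T;T⁻¹] _ b)) := (IsUnit.mk0 _ hb0).map _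
  have hy1 : scalarHom n K m (algebraMap _ _ b) * y = 1 :=
    hu.mul_right_cancel (hy'.trans (one_mul _).symm)
  have h1 : scalarHom n K m f = scalarHom n K m (algebraMap _ _ a) * y := by
    rw [← hab, map_mul, mul_assoc, hy1, mul_one]
  rw [h1]
  exact mul_mem (hL a) hyB

theorem range_le_of_isStarRegular {B : StarSubalgebra K (RankCompletion n K)}
    (hB : IsStarRegular B) (h : Set.range (representation n K) ⊆ B) :
    (limitHom n K).range ≤ B := by
  rintro _ ⟨x, rfl⟩
  obtain ⟨m, x, rfl⟩ := exists_of_eq x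
  have hu : shiftLimit n K ∈ B := h ⟨_, representation_t⟩
  change limitHom n K _ ∈ B
  rw [limitHom_of, Matrix.matrix_eq_sum_single x, map_sum]
  refine sum_mem fun i _ => ?_
  rw [map_sum]
  refine sum_mem fun j _ => ?_
  rw [rationalLevelHom_single, levelHom_single]
  exact mul_mem (scalarHom_mem hB hu m _) (mul_mem (mul_mem (pow_mem hu _)
    (h (corner_mem_range_representation m))) (pow_mem (star_mem hu) _))

theorem starRegularClosure_eq_range (hK : IsPositiveDefinite K) :
    starRegularClosure K (Set.range (representation n K)) = (limitHom n K).range :=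
  le_antisymm (sInf_le ⟨isStarRegular_range hK, range_representation_subset⟩)
    (le_sInf fun _ hB => range_le_of_isStarRegular hB.1 hB.2)

end Range

end Odometer
end

theorem theorem5p4 (n : ℕ → ℕ) [∀ i, (n i).AtLeastTwo] (K : Type*) [Field K] [StarRing K]
    (hK : Odometer.IsPositiveDefinite K) :
    Nonempty (Odometer.starRegularClosure K (Set.range (Odometer.representation n K)) ≃⋆ₐ[K]
      Odometer.RationalLimit n K) := by
  rw [Odometer.starRegularClosure_eq_range hK]
  exact ⟨(StarAlgEquiv.ofInjective (Odometer.limitHom n K) Odometer.limitHom_injective).symm⟩
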